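/- An \emph{$n$-ary Boolean function} is a map $\{0,1\}^n\to\{0,1\}$; a \emph{Boolean function family} is a sequence $(f_n)_{n\in\mathbb N}$ with $f_n$ an $n$-ary Boolean function. Such a family is identified with the unique $f:\{0,1\}^*\to\{0,1\}$ with $f(w)=f_n(w)$ for all $n$ and $w\in\{0,1\}^n$. Let $\mathrm{poly}$ be the set of all $h:\mathbb N\to\mathbb N$ with $h(n)=O(n^k)$ for some $k\in\mathbb N$. \textbf{Instruction sequences.} There are Boolean registers $\mathrm{in}{:}1,\mathrm{in}{:}2,\dots$, $\mathrm{aux}{:}1,\mathrm{aux}{:}2,\dots$ and $\mathrm{out}$. The basic instructions are $r.\mathrm{get}$ for an input or auxiliary register $r$ (the reply is the contents of $r$) and $r.\mathrm{set}{:}b$ for an auxiliary register or the output register $r$ and $b\in\{0,1\}$ (the contents becomes $b$ and the reply is $b$). A (single-pass) instruction sequence is a non-empty finite sequence of primitive instructions: for a basic instruction $a$, the plain instruction $a$ (perform $a$ and go to the next instruction), the positive test $+a$ (perform $a$ and go to the next instruction on reply $1$, skip the next instruction on reply $0$), the negative test $-a$ (the same with the replies interchanged); forward jumps $\#l$, $l\in\mathbb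 N$ (go to the $l$-th next instruction); and the termination instruction $!$. If $l=0$, or if there is no instruction to proceed with, execution becomes inactive and never terminates. An instruction sequence $X$ \emph{computes} $f:\{0,1\}^n\to\{0,1\}$ if there is an $l\in\mathbb N$ such that, for all $b_1,\dots,b_n\in\{0,1\}$, the execution of $X$, started with the registers $\mathrm{in}{:}i$ containing $b_i$ ($1\le i\le n$) and the registers $\mathrm{aux}{:}1,\dots,\mathrm{aux}{:}l$ and $\mathrm{out}$ containing $0$, performs basic instructions on these registers only and terminates with $f(b_1,\dots,b_n)$ in $\mathrm{out}$. \textbf{The class NPLIS.} $\mathrm{PLIS}$ is the class of all Boolean function families $(f_n)$ for which there is an $h\in\mathrm{poly}$ such that, for every $n$, some instruction sequence of length at most $h(n)$ computes $f_n$. $\mathrm{NPLIS}$ is the class of all Boolean function families $(f_n)$ for which there are a monotone (non-decreasing) $h\in\mathrm{poly}$ and a family $(g_n)\in\mathrm{PLIS}$ such that, for all $n\in\mathbb N$ and $w\in\{0,1\}^n$, $$f_n(w)=1\iff \exists\, c\in\{0,1\}^{h(n)}:\ g_{n+h(n)}(wc)=1 .$$ \textbf{The class NP/poly.} For $w=b_1\cdots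 b_n$ and $c$ in $\{0,1\}^*$ let $\langle w,c\rangle=b_1b_1\cdots b_nb_n\,1\,0\,c$. Let $\mathrm P$ be the class of functions $\{0,1\}^*\to\{0,1\}$ computable in polynomial time by a deterministic Turing machine; let $\mathrm{NP}$ be the class of all $f:\{0,1\}^*\to\{0,1\}$ for which there are a polynomial $p$ with coefficients in $\mathbb N$ and a $g\in\mathrm P$ such that $f(w)=1\iff\exists\,c\in\{0,1\}^{p(|w|)}:\ g(\langle w,c\rangle)=1$ for all $w$; and let $\mathrm{NP/poly}$ be the class of all $f:\{0,1\}^*\to\{0,1\}$ for which there are a $g\in\mathrm{NP}$ and an advice function $a:\mathbb N\to\{0,1\}^*$ with $|a(n)|\le h(n)$ for all $n$ and some $h\in\mathrm{poly}$, such that $f(w)=g(\langle w,a(|w|)\rangle)$ for all $w\in\{0,1\}^*$. \textbf{Theorem.} Under the identification of Boolean function families with functions $\{0,1\}^*\to\{0,1\}$, $\mathrm{NPLIS}=\mathrm{NP/poly}$. -/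

import Mathlib

namespace InSeq

/-! ### Instruction sequences acting on Boolean registers -/

/-- Foci, the names of Boolean registers. Indices start at `0`: `inp i` and `aux i` name the
`(i+1)`-th input register and the `(i+1)`-th auxiliary register. -/
inductive Focus
  | inp (i : ℕ)
  | aux (i : ℕ)
  | out
deriving DecidableEq

/-- Methods of Boolean registers. -/
inductive Method
  | set (b : Bool)
  | get
deriving DecidableEq

/-- A basic instruction (equivalently, a basic action) `f.m`. -/
structure BasicInstr where
  focus : Focus
  method : Method
deriving DecidableEq

/-- Primitive instructions: plain basic instructions, positive and negative tests, forward jumps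
and termination. -/
inductive Instr
  | basic (a : BasicInstr)
  | ptst (a : BasicInstr)
  | ntst (a : BasicInstr)
  | fjmp (l : ℕ)
  | halt
deriving DecidableEq

/-- Finite threads. `tau x` performs the internal action and proceeds as `x`; since the reply to
the internal action is always positive, it needs only one continuation. `pcc x a y` performs `a`
and proceeds as `x` on reply `true` and as `y` on reply `false`. -/
inductive Thread
  | inaction
  | terminated
  | tau (x : Thread)
  | pcc (x : Thread) (a : BasicInstr) (y : Thread)

/-- Auxiliary termination measure for thread extraction. -/
def extrMeasure : List Instr → ℕ
  | [] => 0
  | .ptst _ :: X => 2 * X.length + 3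
  | .ntst _ :: X => 2 * X.length + 3
  | _ :: X => 2 * X.length + 2

theorem extrMeasure_le (X : List Instr) : extrMeasure X ≤ 2 * X.length + 1 := by
  rcases X with _ | ⟨u, X⟩
  · simp [extrMeasure]
  · cases u <;> simp [extrMeasure] <;> omega

/-- Thread extraction: the behaviour produced by a finite sequence of instructions. The empty
sequence, which is not an instruction sequence, stands for the absence of an instruction to proceed
with. -/
def extr : List Instr → Thread
  | [] => .inaction
  | .basic a :: X => .pcc (extr X) a (extr X)
  | .ptst a :: X => .pcc (extr X) a (extr (.fjmp 2 :: X))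
  | .ntst a :: X => .pcc (extr (.fjmp 2 :: X)) a (extr X)
  | .fjmp 0 :: _ => .inaction
  | .fjmp 1 :: X => extr X
  | .fjmp (_ + 2) :: [] => .inaction
  | .fjmp (l + 2) :: _ :: X => extr (.fjmp (l + 1) :: X)
  | .halt :: _ => .terminated
termination_by X => extrMeasure X
decreasing_by
  all_goals
    first
    | exact lt_of_le_of_lt (extrMeasure_le X) (by simp only [extrMeasure]; omega)
    | (simp only [extrMeasure, List.length_cons]; omega)

/-- Services: the empty service and the Boolean registers with their contents. -/
inductive Service
  | empty
  | BR (b : Bool)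
deriving DecidableEq

/-- The service that results from processing a method. -/
def Service.derive : Method → Service → Service
  | _, .empty => .empty
  | .set b, .BR _ => .BR b
  | .get, .BR b => .BR b

/-- The reply to a request to process a method; `none` stands for a blocked request. -/
def Service.reply : Method → Service → Option Bool
  | _, .empty => none
  | .set b, .BR _ => some b
  | .get, .BR b => some b

/-- The use operator: the thread that results if the service named `f`, initially `S`, processes
all the requests made to it. -/
def Thread.use (f : Focus) : Thread → Service → Thread
  | .terminated, _ => .terminated
  | .inaction, _ => .inaction
  | .tau x, S => .tau (x.use f S)
  | .pcc x a y, S =>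
    if a.focus = f then
      match S.reply a.method with
      | some true => .tau (x.use f (S.derive a.method))
      | some false => .tau (y.use f (S.derive a.method))
      | none => .tau .inaction
    else .pcc (x.use f S) a (y.use f S)

/-- The apply operator: the service that results from `S`, named `f`, on termination. -/
def Thread.apply (f : Focus) : Thread → Service → Service
  | .terminated, S => S
  | .inaction, _ => .empty
  | .tau x, S => x.apply f S
  | .pcc x a y, S =>
    if a.focus = f then
      match S.reply a.method with
      | some true => x.apply f (S.derive a.method)
      | some false => y.apply f (S.derive a.method)
      | none => .empty
    else .empty

/-- The thread `t` using the first `l` auxiliary registers, all with initial contents `false`. -/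
def useAux (l : ℕ) (t : Thread) : Thread :=
  (List.range l).foldl (fun t j => t.use (.aux j) (.BR false)) t

/-- The thread `t` using the first `n` input registers, with contents `b`. -/
def useInp {n : ℕ} (b : Fin n → Bool) (t : Thread) : Thread :=
  (List.finRange n).foldl (fun t (i : Fin n) => t.use (.inp i) (.BR (b i))) t

/-- `X` computes the `n`-ary Boolean function `f`. -/
def Computes {n : ℕ} (X : List Instr) (f : (Fin n → Bool) → Bool) : Prop :=
  ∃ l : ℕ, ∀ b : Fin n → Bool,
    (useInp b (useAux l (extr X))).apply .out (.BR false) = .BR (f b)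

/-- Basic instructions permitted in instruction sequences: input registers can only be read, the
output register can only be written. -/
def BasicInstr.Permitted : BasicInstr → Prop
  | ⟨.inp _, .get⟩ => True
  | ⟨.inp _, .set _⟩ => False
  | ⟨.aux _, _⟩ => True
  | ⟨.out, .set _⟩ => True
  | ⟨.out, .get⟩ => False

/-- Primitive instructions built from permitted basic instructions. -/
def Instr.Permitted : Instr → Prop
  | .basic a => a.Permitted
  | .ptst a => a.Permitted
  | .ntst a => a.Permitted
  | .fjmp _ => True
  | .halt => True

/-- The non-empty finite instruction sequences acting on Boolean registers. -/
def ISbr : Set (List Instr) :=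
  {X | X ≠ [] ∧ ∀ u ∈ X, u.Permitted}

/-! ### Non-uniform complexity classes -/

/-- A Boolean function family has an `n`-ary Boolean function for each `n`. -/
abbrev BoolFamily := (n : ℕ) → (Fin n → Bool) → Bool

/-- Identification of Boolean function families with functions from bit strings to `Bool`:
`f w = fₙ w` for each string `w` of length `n`. -/
def familyEquiv : BoolFamily ≃ (List Bool → Bool) where
  toFun F w := F w.length w.get
  invFun f n w := f (List.ofFn w)
  left_inv F := by
    have key : ∀ (m n : ℕ) (v : Fin m → Bool) (w : Fin n → Bool) (h : m = n),
        (∀ i : Fin m, v i = w (Fin.cast h i)) → F m v = F n w := by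
      rintro m n v w rfl h
      exact congrArg _ (funext h)
    funext n w
    exact key _ _ _ _ List.length_ofFn (fun i => by simp [Fin.cast])
  right_inv f := by
    funext w
    simp

/-- The functions `h : ℕ → ℕ` with `h n = O(n ^ k)` for some `k`. -/
def poly : Set (ℕ → ℕ) :=
  {h | ∃ k : ℕ, (fun n => (h n : ℝ)) =O[Filter.atTop] fun n => (n : ℝ) ^ k}

/-- The families computed by instruction sequences from `IS` of lengths bounded by a function
from `F`. -/
def nuc (IS : Set (List Instr)) (F : Set (ℕ → ℕ)) : Set BoolFamily :=
  {f | ∃ h ∈ F, ∀ n, ∃ X ∈ IS, Computes X (f n) ∧ X.length ≤ h n}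

/-- The families with certificates of monotone length from `F` that are checked by a family from
`nuc IS F`. -/
def ndnuc (IS : Set (List Instr)) (F : Set (ℕ → ℕ)) : Set BoolFamily :=
  {f | ∃ h ∈ F, Monotone h ∧ ∃ g ∈ nuc IS F, ∀ (n : ℕ) (w : Fin n → Bool),
    f n w = true ↔ ∃ c : Fin (h n) → Bool, g (n + h n) (Fin.append w c) = true}

/-- Families computed by polynomial-length instruction sequences. -/
def PLIS : Set BoolFamily := nuc ISbr poly

/-- The nondeterministic counterpart of `PLIS`. -/
def NPLIS : Set BoolFamily := ndnuc ISbr poly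

/-! ### Classical complexity classes -/

/-- The pairing function on bit strings that converts `b₁…bₙ` and `c` into
`b₁b₁…bₙbₙ` followed by `1`, `0` and `c`. -/
def pairing (w c : List Bool) : List Bool :=
  w.flatMap (fun b => [b, b]) ++ true :: false :: c

/-- The class P: functions computed in polynomial time by a deterministic multi-stack Turing
machine with finite alphabets. -/
def PTime : Set (List Bool → Bool) :=
  {f | ∃ M : Turing.TM2ComputableInPolyTime (fun w : List Bool => w) Computability.encodeBool f,
    ∀ k, Finite (M.tm.Γ k)}

/-- The class NP, in terms of P and certificates of polynomial length. -/
def NPTime : Set (List Bool → Bool) :=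
  {f | ∃ p : Polynomial ℕ, ∃ g ∈ PTime, ∀ w : List Bool,
    f w = true ↔ ∃ c : List Bool, c.length = p.eval w.length ∧ g (pairing w c) = true}

/-- The class `C/F` of functions in `C` with advice that depends only on the length of the input and
whose length is bounded by a function from `F`. -/
def withAdvice (C : Set (List Bool → Bool)) (F : Set (ℕ → ℕ)) : Set (List Bool → Bool) :=
  {f | ∃ g ∈ C, ∃ h ∈ F, ∃ a : ℕ → List Bool, (∀ n, (a n).length ≤ h n) ∧
    ∀ w : List Bool, f w = g (pairing w (a w.length))}

/-- The class NP/poly. -/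
def NPpoly : Set (List Bool → Bool) := withAdvice NPTime poly

end InSeq

namespace InSeq

/-! ### Operational semantics of instruction sequences -/

/-! Both inclusions pass through lists of Boolean functions, each computed from functions earlier in
the list or from input bits.

NP/poly in NPLIS: a stack machine step is local. The new control state depends only on the control
and the top `D` cells of each stack; the new cell `i` depends also on the cells within distance `D`
of `i` (`stepAux_local`, `totalStep_local`). So the one-hot bits of successive configurations form a
`Chain`, in which each function is determined by a bounded number of earlier ones (`exists_chain`).
Each such function is evaluated by a decision tree of constant size that stores its value in a fresh
auxiliary register (`Chain.exists_instrs`), so a polynomial-time predicate has instruction sequences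
of polynomial length (`exists_instrs_of_mem_PTime`). The advice is hard-wired as constants in the
machine's input. The certificate length need not be monotone in `n`, because it depends on the
advice length; certificates are therefore padded to a monotone polynomial bound `H n`. Then `n + H
n` is injective, so one family of checkers serves all `n`.

NPLIS in NP/poly: jumps only go forward, so one pass over the text simulates a run: keep the number
of instructions still to be skipped, in one-hot form, and the register contents. An instruction
affects boundedly many of these bits in a way that needs new gates, hence at most 19 NAND gates per
instruction (`Tracks.pass`, `Computes.exists_nandChain`). A NAND circuit is then written as a string
of three-bit commands for an accumulator and a tape (`NandChain.exists_perform`), and this string,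
reversed, is the advice. A fixed linear-time stack machine decodes input, advice and certificate and
executes the commands (`verify_pairing`, `verify_mem_PTime`). Longer certificates do no harm, since
the commands compute a function of the first `n + h n` cells only. -/

/-- The contents of the registers after processing a basic instruction. -/
def upd (ρ : Focus → Service) (a : BasicInstr) : Focus → Service :=
  Function.update ρ a.focus ((ρ a.focus).derive a.method)

/-- Execution of a thread on a family of services: the final service named `out`. -/
def exec : Thread → (Focus → Service) → Service
  | .inaction, _ => .empty
  | .terminated, ρ => ρ .out
  | .tau x, ρ => exec x ρ
  | .pcc x a y, ρ =>
    match (ρ a.focus).reply a.method with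
    | some true => exec x (upd ρ a)
    | some false => exec y (upd ρ a)
    | none => .empty

/-- A register in use is private to the thread, so handing it over in advance gives the same final
`out`. The name must differ from `out`, whose content is read at termination. -/
theorem exec_use {f : Focus} (hf : f ≠ .out) (t : Thread) (S : Service) (ρ : Focus → Service) :
    exec (t.use f S) ρ = exec t (Function.update ρ f S) := by
  induction t generalizing S ρ with
  | inaction => rfl
  | terminated => simp [Thread.use, exec, Function.update_of_ne hf.symm]
  | tau x ih => simp [Thread.use, exec, ih]
  | pcc x a y ihx ihy =>
    by_cases h : a.focus = f
    · subst h
      rcases hr : S.reply a.method with _ | _ | _ <;>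
        simp [Thread.use, exec, hr, upd, ihx, ihy]
    · rcases hr : (ρ a.focus).reply a.method with _ | _ | _ <;>
        simp [Thread.use, exec, hr, upd, ihx, ihy, h, Function.update_comm h]

theorem apply_eq_exec (t : Thread) (S : Service) :
    t.apply .out S = exec t (Function.update (fun _ => .empty) .out S) := by
  induction t generalizing S with
  | inaction => rfl
  | terminated => simp [Thread.apply, exec]
  | tau x ih => simp [Thread.apply, exec, ih]
  | pcc x a y ihx ihy =>
    by_cases h : a.focus = .out
    · rcases hr : S.reply a.method with _ | _ | _ <;>
        simp [Thread.apply, exec, hr, upd, ihx, ihy, h]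
    · simp [Thread.apply, exec, h, Service.reply]

theorem exec_foldl_use {ι : Type*} (g : ι → Focus) (S : ι → Service) (hg : ∀ i, g i ≠ .out)
    (l : List ι) (t : Thread) (ρ : Focus → Service) :
    exec (l.foldl (fun t i => t.use (g i) (S i)) t) ρ =
      exec t (l.foldr (fun i ρ => Function.update ρ (g i) (S i)) ρ) := by
  induction l generalizing t with
  | nil => rfl
  | cons i l ih => simp [ih, exec_use (hg i)]

theorem foldr_update_of_notMem {ι : Type*} (g : ι → Focus) (S : ι → Service) (l : List ι)
    (ρ : Focus → Service) (f : Focus) (h : ∀ i ∈ l, f ≠ g i) :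
    l.foldr (fun i ρ => Function.update ρ (g i) (S i)) ρ f = ρ f := by
  induction l with
  | nil => rfl
  | cons i l ih =>
    rw [List.foldr_cons, Function.update_of_ne (h i (by simp)), ih]
    exact fun j hj => h j (by simp [hj])

theorem foldr_update_of_mem {ι : Type*} (g : ι → Focus) (hg : g.Injective) (S : ι → Service)
    (l : List ι) (ρ : Focus → Service) (i : ι) (h : i ∈ l) :
    l.foldr (fun i ρ => Function.update ρ (g i) (S i)) ρ (g i) = S i := by
  induction l with
  | nil => simp at h
  | cons j l ih =>
    rw [List.foldr_cons]
    by_cases hij : i = j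
    · subst hij; simp
    · rw [Function.update_of_ne (fun e => hij (hg e)), ih]
      simpa [hij] using h

/-- The initial registers: inputs `b`, and `l` auxiliary registers and the output register
containing `false`. -/
def env {n : ℕ} (l : ℕ) (b : Fin n → Bool) : Focus → Service
  | .inp i => if h : i < n then .BR (b ⟨i, h⟩) else .empty
  | .aux j => if j < l then .BR false else .empty
  | .out => .BR false

theorem apply_useInp_useAux {n : ℕ} (l : ℕ) (b : Fin n → Bool) (t : Thread) :
    (useInp b (useAux l t)).apply .out (.BR false) = exec t (env l b) := by
  -- The nested uses become one iterated update; distinct names make each register keep the content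
  -- assigned to it.
  rw [apply_eq_exec, useInp, exec_foldl_use (fun i : Fin n => .inp i) _ (by simp), useAux,
    exec_foldl_use _ _ (by simp)]
  congr 1
  have h1 : Function.Injective (fun i : Fin n => Focus.inp i) := by
    intro i j h
    simpa [Fin.ext_iff] using h
  have h2 : Function.Injective Focus.aux := by
    intro i j h
    simpa using h
  funext f
  cases f with
  | inp i =>
    rw [foldr_update_of_notMem _ _ _ _ _ (by simp)]
    by_cases h : i < n
    · simpa [env, h] using foldr_update_of_mem (fun i : Fin n => Focus.inp i) h1
        (fun i => .BR (b i)) (List.finRange n)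
        (Function.update (fun _ => .empty) .out (.BR false)) ⟨i, h⟩ (by simp)
    · rw [foldr_update_of_notMem]
      · simp [env, h]
      · rintro j - e
        simp only [Focus.inp.injEq] at e
        omega
  | aux j =>
    by_cases h : j < l
    · simpa [env, h] using foldr_update_of_mem Focus.aux h2 (fun _ => .BR false) (List.range l)
        (List.foldr (fun (i : Fin n) ρ => Function.update ρ (.inp i) (.BR (b i)))
          (Function.update (fun _ => .empty) .out (.BR false)) (List.finRange n)) j (by simp [h])
    · rw [foldr_update_of_notMem, foldr_update_of_notMem]
      · simp [env, h]
      · simp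
      · rintro i hi e
        simp only [Focus.aux.injEq] at e
        simp at hi
        omega
  | out =>
    rw [foldr_update_of_notMem _ _ _ _ _ (by simp), foldr_update_of_notMem _ _ _ _ _ (by simp)]
    simp [env]

/-- Execution of an instruction sequence after skipping its first `k` instructions. -/
def run : List Instr → ℕ → (Focus → Service) → Service
  | [], _, _ => .empty
  | _ :: X, k + 1, ρ => run X k ρ
  | .basic a :: X, 0, ρ =>
    match (ρ a.focus).reply a.method with
    | some _ => run X 0 (upd ρ a)
    | none => .empty
  | .ptst a :: X, 0, ρ =>
    match (ρ a.focus).reply a.method with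
    | some r => run X (if r then 0 else 1) (upd ρ a)
    | none => .empty
  | .ntst a :: X, 0, ρ =>
    match (ρ a.focus).reply a.method with
    | some r => run X (if r then 1 else 0) (upd ρ a)
    | none => .empty
  | .fjmp 0 :: _, 0, _ => .empty
  | .fjmp (l + 1) :: X, 0, ρ => run X l ρ
  | .halt :: _, 0, ρ => ρ .out

/-- The two claims need a joint induction: a test extracts to a thread with a jump `#2` in one
branch, and a jump extracts by shortening itself along the tail. -/
theorem exec_extr (X : List Instr) :
    (∀ ρ, exec (extr X) ρ = run X 0 ρ) ∧ ∀ k ρ, exec (extr (.fjmp (k + 1) :: X)) ρ = run X k ρ := by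
  induction X with
  | nil =>
    refine ⟨fun ρ => by simp [extr, run, exec], fun k ρ => ?_⟩
    cases k <;> simp [extr, run, exec]
  | cons u X ih =>
    have h0 : ∀ ρ, exec (extr (u :: X)) ρ = run (u :: X) 0 ρ := by
      intro ρ
      cases u with
      | basic a =>
        rcases hr : (ρ a.focus).reply a.method with _ | _ | _ <;> simp [extr, exec, run, hr, ih.1]
      | ptst a =>
        rcases hr : (ρ a.focus).reply a.method with _ | _ | _ <;>
          simp [extr, exec, run, hr, ih.1, ih.2 1]
      | ntst a =>
        rcases hr : (ρ a.focus).reply a.method with _ | _ | _ <;>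
          simp [extr, exec, run, hr, ih.1, ih.2 1]
      | fjmp l =>
        cases l with
        | zero => simp [extr, exec, run]
        | succ l => rw [ih.2]; simp [run]
      | halt => simp [extr, exec, run]
    refine ⟨h0, fun k ρ => ?_⟩
    cases k with
    | zero => rw [extr, h0]
    | succ k => rw [extr, ih.2, run]

theorem computes_iff {n : ℕ} (X : List Instr) (f : (Fin n → Bool) → Bool) :
    Computes X f ↔ ∃ l, ∀ b, run X 0 (env l b) = .BR (f b) := by
  simp only [Computes, apply_useInp_useAux, (exec_extr X).1]

/-! ### Polynomially bounded functions -/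

theorem eval_mono (p : Polynomial ℕ) : Monotone fun n : ℕ => p.eval n := by
  intro m n h
  simp only [Polynomial.eval_eq_sum_range]
  gcongr

theorem mem_poly_iff {h : ℕ → ℕ} : h ∈ poly ↔ ∃ p : Polynomial ℕ, ∀ n, h n ≤ p.eval n := by
  constructor
  · rintro ⟨k, hk⟩
    obtain ⟨C, hC⟩ := hk.bound
    obtain ⟨N, hN⟩ := Filter.eventually_atTop.1 hC
    -- The asymptotic bound covers `n ≥ N`; the constant term, the sum of all earlier values, covers
    -- `n < N`.
    refine ⟨Polynomial.C ⌈C⌉₊ * Polynomial.X ^ k + Polynomial.C (∑ i ∈ Finset.range N, h i),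
      fun n => ?_⟩
    simp only [Polynomial.eval_add, Polynomial.eval_mul, Polynomial.eval_C, Polynomial.eval_pow,
      Polynomial.eval_X]
    rcases lt_or_ge n N with hn | hn
    · exact (Finset.single_le_sum (f := h) (fun _ _ => Nat.zero_le _)
        (Finset.mem_range.2 hn)).trans (Nat.le_add_left _ _)
    · refine le_trans ?_ (Nat.le_add_right _ _)
      have h1 := hN n hn
      simp only [Real.norm_natCast, norm_pow] at h1
      have h2 : (h n : ℝ) ≤ ⌈C⌉₊ * (n : ℝ) ^ k :=
        h1.trans (by gcongr; exact Nat.le_ceil C)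
      exact_mod_cast h2
  · rintro ⟨p, hp⟩
    -- The value of `p` at 1 is the sum of its coefficients, and every monomial is at most the top
    -- power once `n ≥ 1`.
    refine ⟨p.natDegree, Asymptotics.IsBigO.of_bound (p.eval 1 : ℕ) ?_⟩
    filter_upwards [Filter.eventually_ge_atTop 1] with n hn
    simp only [Real.norm_natCast, norm_pow]
    have : h n ≤ p.eval 1 * n ^ p.natDegree := by
      refine (hp n).trans ?_
      simp only [Polynomial.eval_eq_sum_range, Finset.sum_mul, one_pow, mul_one]
      gcongr with i hi
      simp at hi
      omega
    exact_mod_cast this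

/-! ### From chains of Boolean functions to instruction sequences -/

theorem run_append_skip (A Y : List Instr) (k : ℕ) (ρ : Focus → Service) :
    run (A ++ Y) (A.length + k) ρ = run Y k ρ := by
  induction A with
  | nil => simp
  | cons u A ih =>
    rw [List.cons_append, List.length_cons, Nat.add_right_comm, run]
    exact ih

/-- The instruction sequence that sets the register `z` to the value of `φ` at the contents of the
registers in a list, by a binary decision tree. -/
def decisionTree (z : Focus) : List Focus → (List Bool → Bool) → List Instr
  | [], φ => [.basic ⟨z, .set (φ [])⟩]
  | s :: S, φ =>
    .ntst ⟨s, .get⟩ :: .fjmp ((decisionTree z S (φ ∘ List.cons true)).length + 2) ::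
      (decisionTree z S (φ ∘ List.cons true) ++
        .fjmp ((decisionTree z S (φ ∘ List.cons false)).length + 1) ::
          decisionTree z S (φ ∘ List.cons false))

/-- A node adds three instructions to its two subtrees, so length plus 3 doubles with every
register; a leaf has length 1. -/
theorem length_decisionTree (z : Focus) (S : List Focus) (φ : List Bool → Bool) :
    (decisionTree z S φ).length + 3 = 4 * 2 ^ S.length := by
  induction S generalizing φ with
  | nil => simp [decisionTree]
  | cons s S ih =>
    have h1 := ih (φ ∘ List.cons true)
    have h2 := ih (φ ∘ List.cons false)
    simp only [decisionTree, List.length_cons, List.length_append, pow_succ]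
    omega

theorem permitted_decisionTree (z : ℕ) (S : List Focus) (hS : ∀ s ∈ S, s ≠ .out)
    (φ : List Bool → Bool) : ∀ u ∈ decisionTree (.aux z) S φ, u.Permitted := by
  induction S generalizing φ with
  | nil => simp [decisionTree, Instr.Permitted, BasicInstr.Permitted]
  | cons s S ih =>
    intro u hu
    have hs := hS s (by simp)
    have hS' : ∀ s ∈ S, s ≠ .out := fun s h => hS s (by simp [h])
    simp only [decisionTree, List.mem_cons, List.mem_append] at hu
    rcases hu with rfl | rfl | hu | rfl | hu
    · cases s <;> simp_all [Instr.Permitted, BasicInstr.Permitted]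
    · trivial
    · exact ih hS' _ u hu
    · trivial
    · exact ih hS' _ u hu

/-- Reading leaves the registers unchanged, and `z` is written only at a leaf, after all reads. On
reply false the first jump leads past the true subtree and its closing jump; that closing jump leads
past the false subtree. -/
theorem run_decisionTree {z : Focus} (S : List Focus) (φ : List Bool → Bool) (val : Focus → Bool)
    (ρ : Focus → Service) (hS : ∀ s ∈ S, ρ s = .BR (val s)) (hz : ∃ x, ρ z = .BR x)
    (Y : List Instr) :
    run (decisionTree z S φ ++ Y) 0 ρ =
      run Y 0 (Function.update ρ z (.BR (φ (S.map val)))) := by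
  induction S generalizing φ Y with
  | nil =>
    obtain ⟨x, hx⟩ := hz
    simp [decisionTree, run, hx, Service.reply, upd, Service.derive]
  | cons s S ih =>
    have hs : ρ s = .BR (val s) := hS s (by simp)
    have hu : upd ρ ⟨s, .get⟩ = ρ := by
      simp only [upd, hs, Service.derive]
      rw [← hs, Function.update_eq_self]
    have hS' : ∀ s ∈ S, ρ s = .BR (val s) := fun s h => hS s (by simp [h])
    simp only [decisionTree, List.cons_append, List.append_assoc, run, hs, Service.reply, hu]
    cases hv : val s
    · simp only [Bool.false_eq_true, if_false, run]
      rw [run_append_skip, run, ih _ hS']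
      simp [hv]
    · simp only [if_true, run]
      rw [ih _ hS', run]
      have h3 := run_append_skip (decisionTree z S (φ ∘ List.cons false)) Y 0
      simp only [add_zero] at h3
      rw [h3]
      simp [hv]

/-! ### Boolean functions determined by boundedly many earlier ones -/

/-- The functions available in a list: its members and the coordinate functions. -/
def Avail {m : ℕ} (L : List ((Fin m → Bool) → Bool)) (s : (Fin m → Bool) → Bool) : Prop :=
  s ∈ L ∨ ∃ i, s = fun b => b i

/-- `f` factors through the members of `S`. -/
def DeterminedBy {m : ℕ} (S : List ((Fin m → Bool) → Bool)) (f : (Fin m → Bool) → Bool) : Prop :=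
  ∀ b b', (∀ s ∈ S, s b = s b') → f b = f b'

/-- Lists of Boolean functions, latest first, in which each function is determined by at most `d`
functions that are earlier in the list or coordinate functions. -/
inductive Chain {m : ℕ} (d : ℕ) : List ((Fin m → Bool) → Bool) → Prop
  | nil : Chain d []
  | cons {L : List ((Fin m → Bool) → Bool)} (f : (Fin m → Bool) → Bool)
      (S : List ((Fin m → Bool) → Bool)) (hL : Chain d L) (hS : ∀ s ∈ S, Avail L s)
      (hd : S.length ≤ d) (hf : DeterminedBy S f) : Chain d (f :: L)

theorem DeterminedBy.exists_eq {m : ℕ} {S : List ((Fin m → Bool) → Bool)}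
    {f : (Fin m → Bool) → Bool} (h : DeterminedBy S f) :
    ∃ φ : List Bool → Bool, ∀ b, f b = φ (S.map fun s => s b) := by
  classical
  refine ⟨fun l => if h : ∃ b, (S.map fun s => s b) = l then f h.choose else false, fun b => ?_⟩
  have hb : ∃ b', (S.map fun s => s b') = S.map fun s => s b := ⟨b, rfl⟩
  beta_reduce
  rw [dif_pos hb]
  refine h _ _ fun s hs => ?_
  exact (List.map_inj_left.1 hb.choose_spec s hs).symm

/-- The registers hold the values at `b` of the functions in `L`. -/
structure Holds {m : ℕ} (L : List ((Fin m → Bool) → Bool)) (l : ℕ) (b : Fin m → Bool)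
    (ρ : Focus → Service) : Prop where
  inp : ∀ i : Fin m, ρ (.inp i) = .BR (b i)
  out : ρ .out = .BR false
  aux : ∀ j < l, ∃ x, ρ (.aux j) = .BR x
  mem : ∀ L₁ f L₂, L = L₁ ++ f :: L₂ → ρ (.aux L₂.length) = .BR (f b)

theorem holds_env {m : ℕ} (l : ℕ) (b : Fin m → Bool) : Holds [] l b (env l b) where
  inp i := by simp [env]
  out := rfl
  aux j hj := ⟨false, by simp [env, hj]⟩
  mem := by simp

/-- A function is stored in the register indexed by the number of functions before it, so the
register numbered `L.length` is fresh and no earlier value is overwritten. -/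
theorem Holds.cons {m : ℕ} {L : List ((Fin m → Bool) → Bool)} {l : ℕ} {b : Fin m → Bool}
    {ρ : Focus → Service} (h : Holds L l b ρ) (f : (Fin m → Bool) → Bool) :
    Holds (f :: L) l b (Function.update ρ (.aux L.length) (.BR (f b))) where
  inp i := by simp [h.inp]
  out := by simp [h.out]
  aux j hj := by
    by_cases e : j = L.length
    · subst e; simp
    · simpa [Function.update, e] using h.aux j hj
  mem L₁ f' L₂ e := by
    cases L₁ with
    | nil =>
      obtain ⟨rfl, rfl⟩ := List.cons.inj e
      simp
    | cons f₁ L₁ =>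
      obtain ⟨rfl, rfl⟩ := List.cons.inj e
      have : L₂.length ≠ (L₁ ++ f' :: L₂).length := by simp; omega
      rw [Function.update_of_ne (by simpa using this)]
      exact h.mem _ _ _ rfl

theorem Chain.exists_instrs {m d : ℕ} {L : List ((Fin m → Bool) → Bool)} (hL : Chain d L) :
    ∃ X : List Instr, (∀ u ∈ X, u.Permitted) ∧ X.length ≤ L.length * (4 * 2 ^ d) ∧
      ∀ l, L.length ≤ l → ∀ b Y, ∃ ρ, Holds L l b ρ ∧ run (X ++ Y) 0 (env l b) = run Y 0 ρ := by
  induction hL with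
  | nil => exact ⟨[], by simp, by simp, fun l _ b Y => ⟨_, holds_env l b, rfl⟩⟩
  | @cons L f S hL hS hd hf ih =>
    obtain ⟨X, hX, hlen, hrun⟩ := ih
    obtain ⟨φ, hφ⟩ := hf.exists_eq
    have hreg : ∀ s : (Fin m → Bool) → Bool, ∃ r : Focus, s ∈ S → r ≠ .out ∧
        ∀ l b ρ, Holds L l b ρ → ρ r = .BR (s b) := by
      intro s
      by_cases hs : s ∈ S
      · rcases hS s hs with h | ⟨i, rfl⟩
        · obtain ⟨L₁, L₂, rfl⟩ := List.append_of_mem h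
          exact ⟨.aux L₂.length, fun _ => ⟨by simp, fun l b ρ h => h.mem _ _ _ rfl⟩⟩
        · exact ⟨.inp i, fun _ => ⟨by simp, fun l b ρ h => h.inp i⟩⟩
      -- A dummy register for functions outside `S`, so that the choice is total.
      · exact ⟨.out, fun h => absurd h hs⟩
    choose r hr using hreg
    refine ⟨X ++ decisionTree (.aux L.length) (S.map r) φ, ?_, ?_, fun l hl b Y => ?_⟩
    · intro u hu
      rcases List.mem_append.1 hu with hu | hu
      · exact hX u hu
      · refine permitted_decisionTree _ _ ?_ _ u hu
        intro s hs
        obtain ⟨s, hs', rfl⟩ := List.mem_map.1 hs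
        exact (hr s hs').1
    · have h1 := length_decisionTree (.aux L.length) (S.map r) φ
      have h2 : 2 ^ S.length ≤ 2 ^ d := Nat.pow_le_pow_right (by norm_num) hd
      rw [List.length_map] at h1
      simp only [List.length_append, List.length_cons]
      rw [Nat.add_mul, one_mul]
      omega
    · obtain ⟨ρ, hρ, hrunX⟩ := hrun l (by simp at hl; omega) b
        (decisionTree (.aux L.length) (S.map r) φ ++ Y)
      refine ⟨_, hρ.cons f, ?_⟩
      have hval : ∀ s ∈ S.map r, ρ s = .BR (match ρ s with | .BR x => x | .empty => false) := by
        intro s hs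
        obtain ⟨s, hs', rfl⟩ := List.mem_map.1 hs
        rw [(hr s hs').2 l b ρ hρ]
      rw [List.append_assoc, hrunX, run_decisionTree _ _ _ _ hval
        (hρ.aux _ (by simp at hl; omega)), hφ b, List.map_map]
      congr 4
      refine List.map_congr_left fun s hs => ?_
      simp [(hr s hs).2 l b ρ hρ]

theorem Chain.computes {m d : ℕ} {L : List ((Fin m → Bool) → Bool)} (hL : Chain d L)
    {f : (Fin m → Bool) → Bool} (hf : f ∈ L) :
    ∃ X ∈ ISbr, Computes X f ∧ X.length ≤ L.length * (4 * 2 ^ d) + 3 := by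
  obtain ⟨X, hX, hlen, hrun⟩ := hL.exists_instrs
  obtain ⟨L₁, L₂, e⟩ := List.append_of_mem hf
  -- The output register starts at false, so it is enough to set it when the register of `f` holds
  -- true; this costs the 3 extra instructions.
  refine ⟨X ++ [.ptst ⟨.aux L₂.length, .get⟩, .basic ⟨.out, .set true⟩, .halt], ⟨by simp, ?_⟩,
    (computes_iff _ _).2 ⟨L.length, fun b => ?_⟩, by simpa using hlen⟩
  · intro u hu
    rcases List.mem_append.1 hu with hu | hu
    · exact hX u hu
    · simp only [List.mem_cons, List.not_mem_nil, or_false] at hu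
      rcases hu with rfl | rfl | rfl <;> simp [Instr.Permitted, BasicInstr.Permitted]
  · obtain ⟨ρ, hρ, h⟩ := hrun L.length le_rfl b
      [.ptst ⟨.aux L₂.length, .get⟩, .basic ⟨.out, .set true⟩, .halt]
    rw [h]
    have h1 := hρ.mem _ _ _ e
    have h2 := hρ.out
    cases hb : f b <;> simp [run, h1, hb, h2, Service.reply, upd, Service.derive]

open Turing

/-! ### Locality of stack machines -/

/-- Two families of stacks agree on the positions, counted from the top, that satisfy `P`. -/
def AgreeOn {K : Type*} {Γ : K → Type*} (P : ℕ → Prop) (S S' : ∀ k, List (Γ k)) : Prop :=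
  ∀ k i, P i → (S k)[i]? = (S' k)[i]?

/-- A bound on how far the execution of a statement looks into the stacks. -/
def stmtDepth {K : Type*} {Γ : K → Type*} {Λ σ : Type*} : TM2.Stmt Γ Λ σ → ℕ
  | .push _ _ q => stmtDepth q + 1
  | .peek _ _ q => stmtDepth q + 1
  | .pop _ _ q => stmtDepth q + 1
  | .load _ q => stmtDepth q
  | .branch _ q₁ q₂ => max (stmtDepth q₁) (stmtDepth q₂)
  | .goto _ => 0
  | .halt => 0

/-- The positions that determine the contents of position `i` after looking `D` deep. -/
def Window (D i j : ℕ) : Prop := j < D ∨ (i ≤ j + D ∧ j ≤ i + D)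

theorem AgreeOn.push {K : Type*} [DecidableEq K] {Γ : K → Type*} {P Q : ℕ → Prop}
    {S S' : ∀ k, List (Γ k)} (h : AgreeOn Q S S') (h₀ : ∀ j, P j → Q j)
    (h₁ : ∀ j, P (j + 1) → Q j) (k : K) (x : Γ k) :
    AgreeOn P (Function.update S k (x :: S k)) (Function.update S' k (x :: S' k)) := by
  intro k' i hi
  by_cases hk : k' = k
  · subst hk
    cases i with
    | zero => simp
    | succ i => simpa using h k' i (h₁ i hi)
  · rw [Function.update_of_ne hk, Function.update_of_ne hk]
    exact h k' i (h₀ i hi)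

theorem AgreeOn.pop {K : Type*} [DecidableEq K] {Γ : K → Type*} {P Q : ℕ → Prop}
    {S S' : ∀ k, List (Γ k)} (h : AgreeOn Q S S') (h₀ : ∀ j, P j → Q j)
    (h₁ : ∀ j, P j → Q (j + 1)) (k : K) :
    AgreeOn P (Function.update S k (S k).tail) (Function.update S' k (S' k).tail) := by
  intro k' i hi
  by_cases hk : k' = k
  · subst hk
    simpa using h k' (i + 1) (h₁ i hi)
  · rw [Function.update_of_ne hk, Function.update_of_ne hk]
    exact h k' i (h₀ i hi)

/-- Agreement on the top `D` cells makes every pop, peek and branch act alike in both runs. A push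
or a pop shifts positions by one and lowers the remaining depth by one, so a window for the rest of
the statement fits into the larger window before it. -/
theorem stepAux_local {K : Type*} [DecidableEq K] {Γ : K → Type*} {Λ σ : Type*}
    (q : TM2.Stmt Γ Λ σ) (D : ℕ) (hD : stmtDepth q ≤ D) (v : σ) (S S' : ∀ k, List (Γ k))
    (h : AgreeOn (· < D) S S') :
    (TM2.stepAux q v S).l = (TM2.stepAux q v S').l ∧
    (TM2.stepAux q v S).var = (TM2.stepAux q v S').var ∧
    ∀ i, AgreeOn (Window D i) S S' →
      AgreeOn (· = i) (TM2.stepAux q v S).stk (TM2.stepAux q v S').stk := by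
  induction q generalizing D v S S' with
  | push k f q ih =>
    obtain ⟨D, rfl⟩ : ∃ D', D = D' + 1 := ⟨D - 1, by simp [stmtDepth] at hD; omega⟩
    obtain ⟨h1, h2, h3⟩ := ih D (by simpa [stmtDepth] using hD) v
      (Function.update S k (f v :: S k)) (Function.update S' k (f v :: S' k))
      (h.push (fun j hj => by omega) (fun j hj => by omega) k (f v))
    refine ⟨h1, h2, fun i hi => h3 i (hi.push ?_ ?_ k (f v))⟩ <;> intro j hj <;>
      simp only [Window] at hj ⊢ <;> omega
  | peek k f q ih =>
    have hk : (S k).head? = (S' k).head? := by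
      simpa [List.head?_eq_getElem?] using h k 0 (by simp [stmtDepth] at hD; omega)
    simpa [hk] using ih D (by simp [stmtDepth] at hD; omega) (f v (S' k).head?) S S' h
  | pop k f q ih =>
    have hk : (S k).head? = (S' k).head? := by
      simpa [List.head?_eq_getElem?] using h k 0 (by simp [stmtDepth] at hD; omega)
    obtain ⟨D, rfl⟩ : ∃ D', D = D' + 1 := ⟨D - 1, by simp [stmtDepth] at hD; omega⟩
    obtain ⟨h1, h2, h3⟩ := ih D (by simpa [stmtDepth] using hD) (f v (S' k).head?)
      (Function.update S k (S k).tail) (Function.update S' k (S' k).tail)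
      (h.pop (fun j hj => by omega) (fun j hj => by omega) k)
    simp only [TM2.stepAux, hk]
    refine ⟨h1, h2, fun i hi => h3 i (hi.pop ?_ ?_ k)⟩ <;> intro j hj <;>
      simp only [Window] at hj ⊢ <;> omega
  | load a q ih => simpa using ih D hD (a v) S S' h
  | branch p q₁ q₂ ih₁ ih₂ =>
    simp only [stmtDepth, max_le_iff] at hD
    cases hp : p v
    · simpa [hp] using ih₂ D hD.2 v S S' h
    · simpa [hp] using ih₁ D hD.1 v S S' h
  | goto l =>
    refine ⟨rfl, rfl, fun i hi k j hj => hi k j ?_⟩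
    simp only [Window]
    omega
  | halt =>
    refine ⟨rfl, rfl, fun i hi k j hj => hi k j ?_⟩
    simp only [Window]
    omega

/-- The step function made total: halted configurations do not change. -/
def totalStep (tm : FinTM2) (c : tm.Cfg) : tm.Cfg := (tm.step c).getD c

/-- A halted configuration is a fixed point of the total step, so an evaluation within time `t` has
its result after exactly `t` total steps. All inputs of one length can thus be run for the same
time. -/
theorem totalStep_iterate_of_evals (tm : FinTM2) (c c' : tm.Cfg) (hc' : c'.l = none) (t : ℕ)
    (h : StateTransition.EvalsToInTime tm.step c (some c') t) : (totalStep tm)^[t] c = c' := by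
  have hfix : ∀ s, (totalStep tm)^[s] c' = c' := by
    intro s
    apply Function.iterate_fixed
    obtain ⟨l, v, S⟩ := c'
    cases hc'
    rfl
  have hev : ∀ s (c : tm.Cfg), (flip bind tm.step)^[s] (some c) = some c' →
      (totalStep tm)^[s] c = c' := by
    intro s
    induction s with
    | zero => intro c h; simpa using h
    | succ s ih =>
      intro c h
      rw [Function.iterate_succ_apply] at h ⊢
      have hb : flip bind tm.step (some c) = tm.step c := rfl
      rw [hb] at h
      cases hs : tm.step c with
      | none =>
        rw [hs] at h
        have : ∀ s, (flip bind tm.step)^[s] none = none :=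
          fun s => Function.iterate_fixed rfl s
        rw [this] at h
        cases h
      | some c₁ =>
        rw [hs] at h
        have : totalStep tm c = c₁ := by rw [totalStep, hs]; rfl
        rw [this]
        exact ih c₁ h
  obtain ⟨r, hr⟩ := Nat.exists_eq_add_of_le h.steps_le_m
  have := hev h.steps c h.evals_in_steps
  rw [hr, Nat.add_comm, Function.iterate_add_apply, this, hfix]

/-- A depth that bounds the depths of all statements of a machine. -/
noncomputable def machineDepth (tm : FinTM2) : ℕ :=
  letI := tm.ΛFin
  Finset.univ.sup fun l => stmtDepth (tm.m l)

theorem totalStep_local (tm : FinTM2) (c c' : tm.Cfg) (hl : c.l = c'.l) (hv : c.var = c'.var)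
    (h : AgreeOn (· < machineDepth tm) c.stk c'.stk) :
    (totalStep tm c).l = (totalStep tm c').l ∧ (totalStep tm c).var = (totalStep tm c').var ∧
    ∀ i, AgreeOn (Window (machineDepth tm) i) c.stk c'.stk →
      AgreeOn (· = i) (totalStep tm c).stk (totalStep tm c').stk := by
  obtain ⟨l, v, S⟩ := c
  obtain ⟨l', v', S'⟩ := c'
  obtain rfl : l = l' := hl
  obtain rfl : v = v' := hv
  cases l with
  | none =>
    refine ⟨rfl, rfl, fun i hi k j hj => hi k j ?_⟩
    simp only [Window]
    omega
  | some l =>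
    let := tm.ΛFin
    exact stepAux_local (tm.m l) (machineDepth tm)
      (Finset.le_sup (f := fun l => stmtDepth (tm.m l)) (Finset.mem_univ l)) v S S' h

/-! ### Configurations of a stack machine as chains of Boolean functions -/

section
variable (tm : FinTM2)

/-- Names of the bits that describe a configuration. -/
inductive CfgBit
  | ctl (x : Option tm.Λ × tm.σ)
  | cell (i : ℕ) (x : Σ k, tm.Γ k)

variable {tm}

open Classical in
/-- The value of a bit in a configuration. -/
noncomputable def CfgBit.val (c : tm.Cfg) : CfgBit tm → Bool
  | .ctl x => decide ((c.l, c.var) = x)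
  | .cell i x => decide ((c.stk x.1)[i]? = some x.2)

theorem CfgBit.val_ctl_congr {c c' : tm.Cfg} (hl : c.l = c'.l) (hv : c.var = c'.var)
    (y : Option tm.Λ × tm.σ) : (CfgBit.ctl y).val c = (CfgBit.ctl y).val c' := by
  simp [CfgBit.val, hl, hv]

theorem CfgBit.val_cell_congr {c c' : tm.Cfg} {i : ℕ} {x : Σ k, tm.Γ k}
    (h : (c.stk x.1)[i]? = (c'.stk x.1)[i]?) :
    (CfgBit.cell i x).val c = (CfgBit.cell i x).val c' := by
  rw [Bool.eq_iff_iff]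
  simp only [CfgBit.val, decide_eq_true_iff]
  exact Eq.congr_left h

variable (tm) [∀ k, Finite (tm.Γ k)]

instance : Finite (Option tm.Λ × tm.σ) :=
  haveI := tm.ΛFin
  haveI := tm.σFin
  inferInstance

instance : Finite (Σ k, tm.Γ k) :=
  haveI := tm.kFin
  inferInstance

/-- The bits of the control and of the cells at the positions in a list. -/
noncomputable def bitsAt (P : List ℕ) : List (CfgBit tm) :=
  (Set.toFinite (Set.univ : Set (Option tm.Λ × tm.σ))).toFinset.toList.map .ctl ++
    P.flatMap fun i =>
      (Set.toFinite (Set.univ : Set (Σ k, tm.Γ k))).toFinset.toList.map (.cell i)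

theorem exists_length_bitsAt : ∃ C, ∀ P, (bitsAt tm P).length ≤ C * (P.length + 1) := by
  refine ⟨(Set.toFinite (Set.univ : Set (Option tm.Λ × tm.σ))).toFinset.card +
    (Set.toFinite (Set.univ : Set (Σ k, tm.Γ k))).toFinset.card, fun P => ?_⟩
  simp only [bitsAt, List.length_append, List.length_map, Finset.length_toList,
    List.length_flatMap, List.map_const', List.sum_replicate, smul_eq_mul]
  nlinarith

variable {tm}

theorem ctl_mem_bitsAt (P : List ℕ) (x : Option tm.Λ × tm.σ) : .ctl x ∈ bitsAt tm P := by
  simp [bitsAt]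

theorem cell_mem_bitsAt {P : List ℕ} {i : ℕ} {x : Σ k, tm.Γ k} :
    .cell i x ∈ bitsAt tm P ↔ i ∈ P := by
  simp [bitsAt]

/-- The encoding is one-hot: the control bit that is on names the control, and the bits of a cell
tell its symbol, or its absence when all are off. -/
theorem eq_of_val_eq {P : List ℕ} {c c' : tm.Cfg} (h : ∀ β ∈ bitsAt tm P, β.val c = β.val c') :
    c.l = c'.l ∧ c.var = c'.var ∧ AgreeOn (· ∈ P) c.stk c'.stk := by
  have h1 := h _ (ctl_mem_bitsAt P (c.l, c.var))
  simp only [CfgBit.val, decide_true] at h1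
  obtain ⟨h2, h3⟩ := Prod.mk.inj (@of_decide_eq_true _ (_) h1.symm)
  refine ⟨h2.symm, h3.symm, fun k i hi => Option.ext fun γ => ?_⟩
  simpa [CfgBit.val] using h (.cell i ⟨k, γ⟩) (cell_mem_bitsAt.2 hi)

/-- All functions added draw on `L` alone, so their mutual order is immaterial: this adds one layer
of a circuit. -/
theorem Chain.append {m d : ℕ} {L : List ((Fin m → Bool) → Bool)} (hL : Chain d L)
    (L' : List ((Fin m → Bool) → Bool))
    (h : ∀ f ∈ L', ∃ S, (∀ s ∈ S, Avail L s) ∧ S.length ≤ d ∧ DeterminedBy S f) :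
    Chain d (L' ++ L) := by
  induction L' with
  | nil => exact hL
  | cons f L' ih =>
    obtain ⟨S, h1, h2, h3⟩ := h f (by simp)
    refine .cons f S (ih fun f hf => h f (by simp [hf])) (fun s hs => ?_) h2 h3
    exact (h1 s hs).imp (fun h => by simp [h]) id

/-- The list of positions in a window. -/
def windowList (D i : ℕ) : List ℕ := List.range D ++ List.range' (i - D) (i + D + 1 - (i - D))

theorem mem_windowList {D i j : ℕ} : j ∈ windowList D i ↔ Window D i j := by
  simp only [windowList, Window, List.mem_append, List.mem_range, List.mem_range'_1]
  omega

theorem length_windowList (D i : ℕ) : (windowList D i).length ≤ 3 * D + 1 := by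
  simp only [windowList, List.length_append, List.length_range, List.length_range']
  omega

/-- The bits of the configuration are constant or given by one coordinate. -/
def InputLike {m : ℕ} (c₀ : (Fin m → Bool) → tm.Cfg) : Prop :=
  ∀ β : CfgBit tm, ∃ S : List ((Fin m → Bool) → Bool), (∀ s ∈ S, ∃ i, s = fun b => b i) ∧
    S.length ≤ 1 ∧ DeterminedBy S fun b => β.val (c₀ b)

variable (tm) in
-- One layer of bits per time step. Knowing the first `R` positions after a step requires the first
-- `R + D` before it, so the induction on time leaves `R` free.
theorem exists_chain : ∃ C d : ℕ, ∀ (m : ℕ) (c₀ : (Fin m → Bool) → tm.Cfg), InputLike c₀ →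
    ∀ t R : ℕ, ∃ L, Chain d L ∧
      (∀ β ∈ bitsAt tm (List.range R), (fun b => β.val ((totalStep tm)^[t] (c₀ b))) ∈ L) ∧
      L.length ≤ (t + 1) * (C * (R + machineDepth tm * t + 1)) := by
  obtain ⟨C, hC⟩ := exists_length_bitsAt tm
  set D := machineDepth tm
  -- A window has at most `3 * D + 1` positions, and `bitsAt` adds one unit for the control; the
  -- final `+ 1` leaves room for the single coordinate on which an initial bit may depend, even if
  -- `C` is 0.
  refine ⟨C, C * (3 * D + 2) + 1, fun m c₀ h₀ t => ?_⟩
  induction t with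
  | zero =>
    intro R
    refine ⟨(bitsAt tm (List.range R)).map fun β b => β.val (c₀ b), ?_, ?_, ?_⟩
    · rw [← List.append_nil (List.map _ _)]
      refine Chain.nil.append _ fun f hf => ?_
      obtain ⟨β, -, rfl⟩ := List.mem_map.1 hf
      obtain ⟨S, h1, h2, h3⟩ := h₀ β
      exact ⟨S, fun s hs => .inr (h1 s hs), h2.trans (by omega), h3⟩
    · intro β hβ
      exact List.mem_map.2 ⟨β, hβ, rfl⟩
    · simpa using hC (List.range R)
  | succ t ih =>
    intro R
    obtain ⟨L, hL, hmem, hlen⟩ := ih (R + D)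
    refine ⟨((bitsAt tm (List.range R)).map
      fun β b => β.val ((totalStep tm)^[t + 1] (c₀ b))) ++ L, ?_, ?_, ?_⟩
    · refine hL.append _ fun f hf => ?_
      obtain ⟨β, hβ, rfl⟩ := List.mem_map.1 hf
      have key : ∀ P : List ℕ, P.length ≤ 3 * D + 1 → (∀ j ∈ P, j < R + D) →
          (∀ c c' : tm.Cfg, c.l = c'.l → c.var = c'.var → AgreeOn (· ∈ P) c.stk c'.stk →
            β.val (totalStep tm c) = β.val (totalStep tm c')) →
          ∃ S, (∀ s ∈ S, Avail L s) ∧ S.length ≤ C * (3 * D + 2) + 1 ∧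
            DeterminedBy S fun b => β.val ((totalStep tm)^[t + 1] (c₀ b)) := by
        intro P hP hPR hβP
        refine ⟨(bitsAt tm P).map fun β b => β.val ((totalStep tm)^[t] (c₀ b)), ?_, ?_, ?_⟩
        · intro s hs
          obtain ⟨β', hβ', rfl⟩ := List.mem_map.1 hs
          refine .inl (hmem β' ?_)
          cases β' with
          | ctl y => exact ctl_mem_bitsAt _ _
          | cell j y =>
            rw [cell_mem_bitsAt] at hβ' ⊢
            exact List.mem_range.2 (hPR j hβ')
        · rw [List.length_map]
          have h2 : C * (P.length + 1) ≤ C * (3 * D + 2) := Nat.mul_le_mul_left C (by omega)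
          exact ((hC P).trans h2).trans (Nat.le_succ _)
        · intro b b' hb
          obtain ⟨h1, h2, h3⟩ := eq_of_val_eq (P := P) (c := (totalStep tm)^[t] (c₀ b))
            (c' := (totalStep tm)^[t] (c₀ b')) fun β' hβ' => hb _ (List.mem_map.2 ⟨β', hβ', rfl⟩)
          simp only [Function.iterate_succ_apply']
          exact hβP _ _ h1 h2 h3
      cases β with
      | ctl y =>
        have hlenD : (List.range D).length ≤ 3 * D + 1 := by
          rw [List.length_range]
          linarith [Nat.zero_le D]
        refine key (List.range D) hlenD (fun j hj => ?_) fun c c' hl hv h => ?_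
        · rw [List.mem_range] at hj
          omega
        · have := totalStep_local tm c c' hl hv fun k j hj => h k j (List.mem_range.2 hj)
          exact CfgBit.val_ctl_congr this.1 this.2.1 y
      | cell i x =>
        rw [cell_mem_bitsAt, List.mem_range] at hβ
        refine key (windowList D i) (length_windowList D i) (fun j hj => ?_) fun c c' hl hv h => ?_
        · rw [mem_windowList, Window] at hj
          omega
        · have := totalStep_local tm c c' hl hv
            fun k j hj => h k j (mem_windowList.2 (.inl hj))
          exact CfgBit.val_cell_congr
            (this.2.2 i (fun k j hj => h k j (mem_windowList.2 hj)) x.1 i rfl)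
    · intro β hβ
      exact List.mem_append_left _ (List.mem_map.2 ⟨β, hβ, rfl⟩)
    · have h1 := hC (List.range R)
      rw [List.length_range] at h1
      have h2 : C * (R + 1) ≤ C * (R + D * (t + 1) + 1) := by gcongr; omega
      have h3 : R + D + D * t + 1 = R + D * (t + 1) + 1 := by ring
      rw [h3] at hlen
      rw [List.length_append, List.length_map, Nat.add_mul (t + 1) 1, one_mul]
      omega

end

/-! ### Instruction sequences for polynomial-time functions -/

theorem inputLike_initList {m : ℕ} (tm : FinTM2) (e : Bool → tm.Γ tm.k₀)
    (src : List (Bool ⊕ Fin m)) :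
    InputLike fun b : Fin m → Bool => initList tm ((src.map (Sum.elim id b)).map e) := by
  intro β
  cases β with
  | ctl y => exact ⟨[], by simp, by simp, fun b b' _ => rfl⟩
  | cell i x =>
    obtain ⟨k, γ⟩ := x
    by_cases hk : k = tm.k₀
    · subst hk
      have hstk : ∀ b : Fin m → Bool,
          (initList tm ((src.map (Sum.elim id b)).map e)).stk tm.k₀ =
            (src.map (Sum.elim id b)).map e := by
        intro b
        simp [initList]
      rcases hi : src[i]? with _ | b₀ | j
      · refine ⟨[], by simp, by simp, fun b b' _ => CfgBit.val_cell_congr ?_⟩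
        simp only [hstk, List.getElem?_map, hi, Option.map_none]
      · refine ⟨[], by simp, by simp, fun b b' _ => CfgBit.val_cell_congr ?_⟩
        simp only [hstk, List.getElem?_map, hi, Option.map_some, Sum.elim_inl]
      · refine ⟨[fun b => b j], by simpa using ⟨j, rfl⟩, by simp, fun b b' h => CfgBit.val_cell_congr ?_⟩
        have hj : b j = b' j := h (fun b => b j) (by simp)
        simp only [hstk, List.getElem?_map, hi, Option.map_some, Sum.elim_inr, hj]
    · refine ⟨[], by simp, by simp, fun b b' _ => CfgBit.val_cell_congr ?_⟩
      simp [initList, hk]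

/-- The input is a pattern `src` of constants and coordinates, so that advice, separators and
repeated bits can be wired in; the bound depends on the pattern's length, not on the number of
coordinates. -/
theorem exists_instrs_of_mem_PTime {g : List Bool → Bool} (hg : g ∈ PTime) :
    ∃ p : Polynomial ℕ, ∀ (m : ℕ) (src : List (Bool ⊕ Fin m)), ∃ X ∈ ISbr,
      Computes X (fun b => g (src.map (Sum.elim id b))) ∧ X.length ≤ p.eval src.length := by
  obtain ⟨M, hM⟩ := hg
  obtain ⟨C, d, hCd⟩ := exists_chain M.tm
  set D := machineDepth M.tm
  refine ⟨(M.time + 1) * (Polynomial.C C * (Polynomial.C 1 + Polynomial.C D * M.time + 1)) *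
    Polynomial.C (4 * 2 ^ d) + Polynomial.C 3, fun m src => ?_⟩
  set T := M.time.eval src.length with hT
  obtain ⟨L, hL, hmem, hlen⟩ := hCd m _
    (inputLike_initList M.tm M.inputAlphabet.invFun src) T 1
  -- The answer is one bit of the final configuration: whether the top symbol of the output stack
  -- encodes true. Hence `R = 1` suffices.
  have hbit := hmem (.cell 0 ⟨M.tm.k₁, M.outputAlphabet.invFun true⟩)
    (cell_mem_bitsAt.2 (by simp))
  obtain ⟨X, hX, hcomp, hXlen⟩ := hL.computes hbit
  refine ⟨X, hX, ?_, ?_⟩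
  · convert hcomp using 2 with b
    have hout := M.outputsFun (src.map (Sum.elim id b))
    rw [List.length_map] at hout
    rw [totalStep_iterate_of_evals M.tm _ _ rfl T hout]
    rw [Bool.eq_iff_iff]
    simp [CfgBit.val, haltList, Computability.encodeBool]
  · refine hXlen.trans ?_
    simp only [Polynomial.eval_add, Polynomial.eval_mul, Polynomial.eval_C, Polynomial.eval_one,
      ← hT]
    gcongr

/-! ### Functions in NP/poly have polynomial-length instruction sequences -/

theorem length_pairing (w c : List Bool) : (pairing w c).length = 2 * w.length + 2 + c.length := by
  simp [pairing, List.length_flatMap]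
  ring

theorem exists_src_pairing {m : ℕ} (s t : List (Bool ⊕ Fin m)) :
    ∃ r : List (Bool ⊕ Fin m), r.length = 2 * s.length + 2 + t.length ∧ ∀ b : Fin m → Bool,
      r.map (Sum.elim id b) = pairing (s.map (Sum.elim id b)) (t.map (Sum.elim id b)) := by
  refine ⟨s.flatMap (fun x => [x, x]) ++ .inl true :: .inl false :: t, ?_, fun b => ?_⟩
  · simp [List.length_flatMap]
    ring
  · simp [pairing, List.map_flatMap, List.flatMap_map]

theorem const_false_computes (m : ℕ) :
    ∃ X ∈ ISbr, Computes X (fun _ : Fin m → Bool => false) ∧ X.length ≤ 1 :=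
  ⟨[.halt], by simp [ISbr, Instr.Permitted], (computes_iff _ _).2 ⟨0, fun _ => rfl⟩, by simp⟩

theorem NPpoly_subset : NPpoly ⊆ familyEquiv '' NPLIS := by
  classical
  rintro f ⟨g, ⟨p, g₀, hg₀, hg⟩, hA, hApoly, a, ha, hf⟩
  obtain ⟨r, hr⟩ := mem_poly_iff.1 hApoly
  obtain ⟨P, hP⟩ := exists_instrs_of_mem_PTime hg₀
  refine ⟨familyEquiv.symm f, ?_, familyEquiv.apply_symm_apply f⟩
  set Q : Polynomial ℕ := Polynomial.C 2 * Polynomial.X + Polynomial.C 2 + r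
  have hQ : ∀ n, 2 * n + 2 + (a n).length ≤ Q.eval n := by
    intro n
    have := (ha n).trans (hr n)
    simp only [Q, Polynomial.eval_add, Polynomial.eval_mul, Polynomial.eval_C, Polynomial.eval_X]
    omega
  set H : ℕ → ℕ := fun n => (p.comp Q).eval n with hH
  set q : ℕ → ℕ := fun n => p.eval (2 * n + 2 + (a n).length) with hq
  have hHmono : Monotone H := eval_mono _
  have hqH : ∀ n, q n ≤ H n := by
    intro n
    simp only [hH, hq, Polynomial.eval_comp]
    exact eval_mono p (hQ n)
  -- Monotonicity of `H` makes `n + H n` strictly increasing, so the total length reveals `n` and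
  -- the checker knows where the certificate starts.
  have hinj : ∀ n n', n + H n = n' + H n' → n = n' := by
    intro n n' h
    rcases lt_trichotomy n n' with hn | hn | hn
    · have := hHmono hn.le
      omega
    · exact hn
    · have := hHmono hn.le
      omega
  set G : ℕ → List Bool → Bool := fun n x =>
    g₀ (pairing (pairing (x.take n) (a n)) ((x.drop n).take (q n))) with hG
  set g' : BoolFamily := fun m b =>
    if h : ∃ n, n + H n = m then G h.choose (List.ofFn b) else false with hg'
  have hg'eq : ∀ n (b : Fin (n + H n) → Bool), g' (n + H n) b = G n (List.ofFn b) := by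
    intro n b
    have h : ∃ n', n' + H n' = n + H n := ⟨n, rfl⟩
    simp only [hg']
    rw [dif_pos h, hinj _ _ h.choose_spec]
  refine ⟨H, mem_poly_iff.2 ⟨_, fun n => le_rfl⟩, hHmono, g', ?_, fun n w => ?_⟩
  · refine ⟨fun m => (P.comp (Polynomial.C 2 * Q + Polynomial.C 2 + p.comp Q) + 1).eval m,
      mem_poly_iff.2 ⟨_, fun n => le_rfl⟩, fun m => ?_⟩
    by_cases hm : ∃ n, n + H n = m
    · obtain ⟨n, rfl⟩ := hm
      set all : List (Bool ⊕ Fin (n + H n)) := (List.finRange (n + H n)).map .inr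
      have hall : ∀ b : Fin (n + H n) → Bool, all.map (Sum.elim id b) = List.ofFn b := by
        intro b
        simp [all, List.ofFn_eq_map]
      obtain ⟨s₁, hs₁, hs₁'⟩ := exists_src_pairing (all.take n) ((a n).map .inl)
      obtain ⟨s₂, hs₂, hs₂'⟩ := exists_src_pairing s₁ ((all.drop n).take (q n))
      obtain ⟨X, hX, hXc, hXl⟩ := hP _ s₂
      refine ⟨X, hX, ?_, hXl.trans ?_⟩
      · convert hXc using 2 with b
        rw [hg'eq, hs₂', hs₁', List.map_take, List.map_take, List.map_drop, hall]
        simp [hG]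
      · have h1 : s₁.length ≤ Q.eval n := by
          refine le_trans ?_ (hQ n)
          have h : (List.take n all).length ≤ n := List.length_take_le _ _
          rw [hs₁, List.length_map]
          omega
        have h2 : s₂.length ≤ 2 * Q.eval n + 2 + H n := by
          rw [hs₂, List.length_take]
          have := hqH n
          omega
        have h3 : Q.eval n ≤ Q.eval (n + H n) := eval_mono Q (by omega)
        have h4 : H n ≤ (p.comp Q).eval (n + H n) := eval_mono (p.comp Q) (by omega)
        simp only [Polynomial.eval_add, Polynomial.eval_comp, Polynomial.eval_mul,
          Polynomial.eval_C, Polynomial.eval_one] at h4 ⊢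
        refine (eval_mono P ?_).trans (Nat.le_succ _)
        omega
    · obtain ⟨X, hX, hXc, hXl⟩ := const_false_computes m
      refine ⟨X, hX, ?_, hXl.trans ?_⟩
      · convert hXc using 2 with b
        simp [hg', hm]
      · simp
  · have hw : (List.ofFn w).length = n := by simp
    have h1 : familyEquiv.symm f n w = f (List.ofFn w) := rfl
    rw [h1, hf, hg, length_pairing, hw]
    have h2 : ∀ c : Fin (H n) → Bool, g' (n + H n) (Fin.append w c) =
        g₀ (pairing (pairing (List.ofFn w) (a n)) ((List.ofFn c).take (q n))) := by
      intro c
      rw [hg'eq, hG, List.ofFn_fin_append]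
      simp
    constructor
    · rintro ⟨c, hc, hgc⟩
      -- Padding with false up to `H n`; the checker keeps only the first `q n` bits, so `c` is
      -- recovered.
      refine ⟨fun i => c.getD i false, ?_⟩
      rw [h2]
      convert hgc using 3
      have hcl : c.length = q n := hc
      refine List.ext_getElem ?_ fun i hi hi' => ?_
      · rw [List.length_take, List.length_ofFn, hcl]
        exact min_eq_left (hqH n)
      · simp [hi']
    · rintro ⟨c, hc⟩
      rw [h2] at hc
      refine ⟨_, ?_, hc⟩
      rw [List.length_take, List.length_ofFn]
      exact min_eq_left (hqH n)

/-! ### From instruction sequences to chains of NAND gates -/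

/-- Lists of Boolean functions, latest first, in which each function is constantly `true` or the
NAND of functions that are earlier in the list or coordinate functions. -/
inductive NandChain {m : ℕ} : List ((Fin m → Bool) → Bool) → Prop
  | nil : NandChain []
  | const {L : List ((Fin m → Bool) → Bool)} (hL : NandChain L) : NandChain ((fun _ => true) :: L)
  | nand {L : List ((Fin m → Bool) → Bool)} {x y : (Fin m → Bool) → Bool} (hL : NandChain L)
      (hx : Avail L x) (hy : Avail L y) : NandChain ((fun b => !(x b && y b)) :: L)

theorem Avail.mono {m : ℕ} {L L' : List ((Fin m → Bool) → Bool)} {f : (Fin m → Bool) → Bool}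
    (h : Avail L f) (hL : L ⊆ L') : Avail L' f :=
  h.imp (fun h => hL h) id

/-- Each chain that includes `L` can be extended by `n` gates to a chain that provides `f`. -/
def Gen {m : ℕ} (n : ℕ) (L : List ((Fin m → Bool) → Bool)) (f : (Fin m → Bool) → Bool) : Prop :=
  ∀ L₁, L ⊆ L₁ → NandChain L₁ →
    ∃ L', L₁ ⊆ L' ∧ NandChain L' ∧ L'.length ≤ L₁.length + n ∧ Avail L' f

section
variable {m n k : ℕ} {L : List ((Fin m → Bool) → Bool)} {x y : (Fin m → Bool) → Bool}

theorem Gen.of_avail (h : Avail L x) : Gen 0 L x :=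
  fun L₁ hL hc => ⟨L₁, fun _ h => h, hc, by simp, h.mono hL⟩

/-- Because `Gen` allows any chain that includes `L`, the gates for `y` can be put on top of those
for `x`. -/
theorem Gen.nand (hx : Gen n L x) (hy : Gen k L y) :
    Gen (n + k + 1) L fun b => !(x b && y b) := by
  intro L₁ hL hc
  obtain ⟨L₂, h2, hc2, hl2, ha2⟩ := hx L₁ hL hc
  obtain ⟨L₃, h3, hc3, hl3, ha3⟩ := hy L₂ (List.Subset.trans hL h2) hc2
  refine ⟨_ :: L₃, fun f hf => ?_, .nand hc3 (ha2.mono h3) ha3, ?_, .inl (by simp)⟩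
  · exact List.mem_cons_of_mem _ (h3 (h2 hf))
  · simp only [List.length_cons]
    omega

/-- One copy of `x` feeds both inputs of the gate, so the cost of `x` is not doubled. -/
theorem Gen.not (hx : Gen n L x) : Gen (n + 1) L fun b => !(x b) := by
  intro L₁ hL hc
  obtain ⟨L₂, h2, hc2, hl2, ha2⟩ := hx L₁ hL hc
  refine ⟨_ :: L₂, fun f hf => ?_, .nand hc2 ha2 ha2, ?_, .inl (by simp)⟩
  · exact List.mem_cons_of_mem _ (h2 hf)
  · simp only [List.length_cons]
    omega

theorem Gen.and (hx : Gen n L x) (hy : Gen k L y) : Gen (n + k + 2) L fun b => x b && y b := by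
  simpa using (hx.nand hy).not

theorem Gen.or (hx : Gen n L x) (hy : Gen k L y) : Gen (n + k + 3) L fun b => x b || y b := by
  have := hx.not.nand hy.not
  simp only [Bool.not_and, Bool.not_not] at this
  rwa [show n + k + 3 = n + 1 + (k + 1) + 1 by ring]

theorem Gen.mono (hx : Gen n L x) (h : n ≤ k) : Gen k L x := by
  intro L₁ hL hc
  obtain ⟨L', h1, h2, h3, h4⟩ := hx L₁ hL hc
  exact ⟨L', h1, h2, by omega, h4⟩

theorem Gen.true : Gen 1 L fun _ => true :=
  fun L₁ _ hc => ⟨_ :: L₁, List.subset_cons_self _ _, .const hc, by simp, .inl (by simp)⟩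

theorem Gen.const (c : Bool) : Gen 2 L fun _ => c := by
  cases c
  · simpa using Gen.true.not (L := L)
  · exact Gen.true.mono (by norm_num)

end

/-! ### Simulating a run by one pass over the text -/

/-- The reply to a basic instruction on registers with contents `ρ`. -/
def replyB (a : BasicInstr) (ρ : Focus → Bool) : Bool :=
  match a.method with
  | .set b => b
  | .get => ρ a.focus

/-- The effect of a basic instruction on registers with contents `ρ`. -/
def updB (a : BasicInstr) (ρ : Focus → Bool) : Focus → Bool :=
  match a.method with
  | .set b => Function.update ρ a.focus b
  | .get => ρ

/-- The number of instructions to skip after an instruction; `none` if execution ends. -/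
def nextB : Instr → (Focus → Bool) → Option ℕ
  | .basic _, _ => some 0
  | .ptst a, ρ => some (if replyB a ρ then 0 else 1)
  | .ntst a, ρ => some (if replyB a ρ then 1 else 0)
  | .fjmp 0, _ => none
  | .fjmp (l + 1), _ => some l
  | .halt, _ => none

/-- The effect of an instruction on registers with contents `ρ`. -/
def effectB : Instr → (Focus → Bool) → Focus → Bool
  | .basic a, ρ => updB a ρ
  | .ptst a, ρ => updB a ρ
  | .ntst a, ρ => updB a ρ
  | .fjmp _, ρ => ρ
  | .halt, ρ => ρ

/-- The number of instructions to skip after passing an instruction. -/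
def passSkip (u : Instr) (ρ : Focus → Bool) : Option ℕ → Option ℕ
  | none => none
  | some 0 => nextB u ρ
  | some (k + 1) => some k

/-- The contents of the registers after passing an instruction. -/
def passRegs (u : Instr) (ρ : Focus → Bool) : Option ℕ → Focus → Bool
  | some 0 => effectB u ρ
  | _ => ρ

/-- The contents of the output register after passing all instructions, starting with a number of
instructions to skip. -/
def sweep : List Instr → Option ℕ → (Focus → Bool) → Bool
  | [], _, ρ => ρ .out
  | u :: X, s, ρ => sweep X (passSkip u ρ s) (passRegs u ρ s)

theorem sweep_none (X : List Instr) (ρ : Focus → Bool) : sweep X none ρ = ρ .out := by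
  induction X with
  | nil => rfl
  | cons u X ih => exact ih

theorem replyB_eq {a : BasicInstr} {ρ : Focus → Service} {ρ' : Focus → Bool}
    (h : ∀ r y, ρ r = .BR y → ρ' r = y) {r : Bool} (hr : (ρ a.focus).reply a.method = some r) :
    replyB a ρ' = r ∧ ∀ f y, upd ρ a f = .BR y → updB a ρ' f = y := by
  obtain ⟨f₀, _ | _⟩ := a
  · rename_i b
    cases hf : ρ f₀ with
    | empty => simp [hf, Service.reply] at hr
    | BR x =>
      simp only [hf, Service.reply, Option.some.injEq] at hr
      refine ⟨hr, fun f y hy => ?_⟩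
      by_cases e : f = f₀
      · subst e
        simpa [upd, updB, hf, Service.derive] using hy
      · simp only [upd, Function.update_of_ne e] at hy
        simpa [updB, Function.update_of_ne e] using h f y hy
  · cases hf : ρ f₀ with
    | empty => simp [hf, Service.reply] at hr
    | BR x =>
      simp only [hf, Service.reply, Option.some.injEq] at hr
      refine ⟨by simpa [replyB, ← hr] using h _ _ hf, fun f y hy => ?_⟩
      have : upd ρ ⟨f₀, .get⟩ = ρ := by
        simp only [upd, hf, Service.derive]
        rw [← hf, Function.update_eq_self]
      rw [this] at hy
      exact h f y hy

/-- Only runs that end with a Boolean in `out` matter, so the sweep may ignore inaction and give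
absent registers arbitrary contents. -/
theorem sweep_eq_of_run (X : List Instr) (k : ℕ) (ρ : Focus → Service) (ρ' : Focus → Bool)
    (h : ∀ r y, ρ r = .BR y → ρ' r = y) (x : Bool) (hx : run X k ρ = .BR x) :
    sweep X (some k) ρ' = x := by
  induction X generalizing k ρ ρ' with
  | nil => simp [run] at hx
  | cons u X ih =>
    cases k with
    | succ k => exact ih k ρ ρ' h (by simpa [run] using hx)
    | zero =>
      cases u with
      | basic a =>
        cases hr : (ρ a.focus).reply a.method with
        | none => simp [run, hr] at hx
        | some r => exact ih _ _ _ (replyB_eq h hr).2 (by simpa [run, hr] using hx)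
      | ptst a =>
        cases hr : (ρ a.focus).reply a.method with
        | none => simp [run, hr] at hx
        | some r =>
          simp only [sweep, passSkip, nextB, passRegs, effectB, (replyB_eq h hr).1]
          exact ih _ _ _ (replyB_eq h hr).2 (by simpa [run, hr] using hx)
      | ntst a =>
        cases hr : (ρ a.focus).reply a.method with
        | none => simp [run, hr] at hx
        | some r =>
          simp only [sweep, passSkip, nextB, passRegs, effectB, (replyB_eq h hr).1]
          exact ih _ _ _ (replyB_eq h hr).2 (by simpa [run, hr] using hx)
      | fjmp l =>
        cases l with
        | zero => simp [run] at hx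
        | succ l => exact ih l ρ ρ' h (by simpa [run] using hx)
      | halt =>
        simp only [sweep, passSkip, nextB, passRegs, effectB, sweep_none]
        exact h _ _ (by simpa [run] using hx)

/-- The list provides the number of instructions to skip and the contents of the registers. -/
structure Tracks {m : ℕ} (L : List ((Fin m → Bool) → Bool)) (s : (Fin m → Bool) → Option ℕ)
    (ρ : (Fin m → Bool) → Focus → Bool) : Prop where
  skip : ∀ k, Avail L fun b => decide (s b = some k)
  regs : ∀ r, Avail L fun b => ρ b r

section
variable {m : ℕ} {L : List ((Fin m → Bool) → Bool)} {s : (Fin m → Bool) → Option ℕ}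
  {ρ : (Fin m → Bool) → Focus → Bool}

theorem Tracks.gen_replyB (h : Tracks L s ρ) (a : BasicInstr) :
    Gen 2 L fun b => replyB a (ρ b) := by
  obtain ⟨f, _ | _⟩ := a
  · exact Gen.const _
  · exact (Gen.of_avail (h.regs f)).mono (by norm_num)

/-- The possible skip counts after an instruction are known from its text: 0 and 1 after a test, at
most one value otherwise. This is why two exceptional values cover infinitely many indicators. -/
theorem Tracks.gen_nextB (h : Tracks L s ρ) (u : Instr) :
    ∃ k₀, ∀ k, (Gen 3 L fun b => decide (nextB u (ρ b) = some k)) ∧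
      (k ≠ k₀ → k ≠ k₀ + 1 → ∀ b, nextB u (ρ b) ≠ some k) := by
  have hc : ∀ c : Bool, Gen 3 L fun _ => c := fun c => (Gen.const c).mono (by norm_num)
  cases u with
  | basic a => exact ⟨0, fun k => ⟨hc (decide (some 0 = some k)), fun h _ _ e => h (by simpa [nextB] using e.symm)⟩⟩
  | ptst a =>
    refine ⟨0, fun k => ⟨?_, fun h0 h1 b e => ?_⟩⟩
    · match k with
      | 0 =>
        convert (h.gen_replyB a).mono (by norm_num : 2 ≤ 3) using 2 with b
        cases hr : replyB a (ρ b) <;> simp [nextB, hr]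
      | 1 =>
        convert (h.gen_replyB a).not using 2 with b
        cases hr : replyB a (ρ b) <;> simp [nextB, hr]
      | k + 2 =>
        convert hc false using 2 with b
        cases hr : replyB a (ρ b) <;> simp [nextB, hr]
    · cases hr : replyB a (ρ b) <;> simp [nextB, hr] at e <;> omega
  | ntst a =>
    refine ⟨0, fun k => ⟨?_, fun h0 h1 b e => ?_⟩⟩
    · match k with
      | 0 =>
        convert (h.gen_replyB a).not using 2 with b
        cases hr : replyB a (ρ b) <;> simp [nextB, hr]
      | 1 =>
        convert (h.gen_replyB a).mono (by norm_num : 2 ≤ 3) using 2 with b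
        cases hr : replyB a (ρ b) <;> simp [nextB, hr]
      | k + 2 =>
        convert hc false using 2 with b
        cases hr : replyB a (ρ b) <;> simp [nextB, hr]
    · cases hr : replyB a (ρ b) <;> simp [nextB, hr] at e <;> omega
  | fjmp l =>
    cases l with
    | zero => exact ⟨0, fun k => ⟨hc (decide (none = some k)), fun _ _ _ => by simp [nextB]⟩⟩
    | succ l =>
      exact ⟨l, fun k => ⟨hc (decide (some l = some k)), fun h _ _ e => h (by simpa [nextB] using e.symm)⟩⟩
  | halt => exact ⟨0, fun k => ⟨hc (decide (none = some k)), fun _ _ _ => by simp [nextB]⟩⟩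

theorem passSkip_eq_some (u : Instr) (ρ : Focus → Bool) (s : Option ℕ) (k : ℕ) :
    decide (passSkip u ρ s = some k) =
      (decide (s = some (k + 1)) || (decide (s = some 0) && decide (nextB u ρ = some k))) := by
  rw [Bool.eq_iff_iff]
  simp only [Bool.or_eq_true, Bool.and_eq_true, decide_eq_true_iff]
  rcases s with _ | _ | j <;> simp [passSkip]

theorem Tracks.gen_passSkip (h : Tracks L s ρ) (u : Instr) :
    ∃ k₀, ∀ k, (Gen 8 L fun b => decide (passSkip u (ρ b) (s b) = some k)) ∧
      (k ≠ k₀ → k ≠ k₀ + 1 → Avail L fun b => decide (passSkip u (ρ b) (s b) = some k)) := by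
  obtain ⟨k₀, hk₀⟩ := h.gen_nextB u
  simp only [passSkip_eq_some]
  refine ⟨k₀, fun k => ⟨?_, fun h0 h1 => ?_⟩⟩
  · exact (Gen.of_avail (h.skip (k + 1))).or ((Gen.of_avail (h.skip 0)).and (hk₀ k).1)
  -- Away from the two exceptional values, the only way to have `k` left is to have had `k + 1`, and
  -- that indicator is already available.
  · convert h.skip (k + 1) using 2 with b
    simp [(hk₀ k).2 h0 h1 b]

theorem Tracks.gen_updB (h : Tracks L s ρ) (a : BasicInstr) (r : Focus) :
    (Gen 3 L fun b => if s b = some 0 then updB a (ρ b) r else ρ b r) ∧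
      (r ≠ a.focus → Avail L fun b => if s b = some 0 then updB a (ρ b) r else ρ b r) := by
  have h0 : ∀ r, r ≠ a.focus → ∀ b, updB a (ρ b) r = ρ b r := by
    intro r hr b
    obtain ⟨f, _ | _⟩ := a
    · exact Function.update_of_ne hr _ _
    · rfl
  refine ⟨?_, fun hr => by simpa [h0 r hr] using h.regs r⟩
  by_cases hr : r = a.focus
  · subst hr
    obtain ⟨f, b₀ | _⟩ := a
    · cases b₀
      · convert (Gen.of_avail (h.skip 0)).not.and (Gen.of_avail (h.regs f)) using 2 with b
        by_cases hs : s b = some 0 <;> simp [hs, updB]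
      · convert (Gen.of_avail (h.skip 0)).or (Gen.of_avail (h.regs f)) using 2 with b
        by_cases hs : s b = some 0 <;> simp [hs, updB]
    · simpa [updB] using (Gen.of_avail (h.regs f)).mono (by norm_num : 0 ≤ 3)
  · simpa [h0 r hr] using (Gen.of_avail (h.regs r)).mono (by norm_num : 0 ≤ 3)

theorem Tracks.gen_passRegs (h : Tracks L s ρ) (u : Instr) :
    ∃ r₀, ∀ r, (Gen 3 L fun b => passRegs u (ρ b) (s b) r) ∧
      (r ≠ r₀ → Avail L fun b => passRegs u (ρ b) (s b) r) := by
  have hpass : ∀ b r, passRegs u (ρ b) (s b) r =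
      if s b = some 0 then effectB u (ρ b) r else ρ b r := by
    intro b r
    rcases s b with _ | _ | j <;> simp [passRegs]
  simp only [hpass]
  cases u with
  | basic a => exact ⟨a.focus, h.gen_updB a⟩
  | ptst a => exact ⟨a.focus, h.gen_updB a⟩
  | ntst a => exact ⟨a.focus, h.gen_updB a⟩
  | fjmp l =>
    exact ⟨.out, fun r => by
      simpa [effectB] using ⟨(Gen.of_avail (h.regs r)).mono (by norm_num : 0 ≤ 3),
        fun _ => h.regs r⟩⟩
  | halt =>
    exact ⟨.out, fun r => by
      simpa [effectB] using ⟨(Gen.of_avail (h.regs r)).mono (by norm_num : 0 ≤ 3),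
        fun _ => h.regs r⟩⟩

/-- The cost is 8 gates for each of the two exceptional skip counts and 3 for the one register that
can change; everything else is reused. -/
theorem Tracks.pass (h : Tracks L s ρ) (hL : NandChain L) (u : Instr) :
    ∃ L', NandChain L' ∧ L'.length ≤ L.length + 19 ∧
      Tracks L' (fun b => passSkip u (ρ b) (s b)) fun b => passRegs u (ρ b) (s b) := by
  obtain ⟨k₀, hk⟩ := h.gen_passSkip u
  obtain ⟨r₀, hr⟩ := h.gen_passRegs u
  obtain ⟨L₁, s1, c1, l1, a1⟩ := (hk k₀).1 L (fun _ h => h) hL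
  obtain ⟨L₂, s2, c2, l2, a2⟩ := (hk (k₀ + 1)).1 L₁ s1 c1
  have s12 : L ⊆ L₂ := List.Subset.trans s1 s2
  obtain ⟨L₃, s3, c3, l3, a3⟩ := (hr r₀).1 L₂ s12 c2
  have hsub : L ⊆ L₃ := List.Subset.trans s12 s3
  refine ⟨L₃, c3, by omega, fun k => ?_, fun r => ?_⟩
  · by_cases e0 : k = k₀
    · subst e0
      exact a1.mono (List.Subset.trans s2 s3)
    · by_cases e1 : k = k₀ + 1
      · subst e1
        exact a2.mono s3
      · exact ((hk k).2 e0 e1).mono hsub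
  · by_cases e : r = r₀
    · subst e
      exact a3
    · exact ((hr r).2 e).mono hsub

theorem Tracks.sweep (h : Tracks L s ρ) (hL : NandChain L) (X : List Instr) :
    ∃ L', NandChain L' ∧ L'.length ≤ L.length + 19 * X.length ∧
      Avail L' fun b => sweep X (s b) (ρ b) := by
  induction X generalizing L s ρ with
  | nil => exact ⟨L, hL, by simp, h.regs .out⟩
  | cons u X ih =>
    obtain ⟨L₁, c1, l1, t1⟩ := h.pass hL u
    obtain ⟨L₂, c2, l2, a2⟩ := ih t1 c1
    refine ⟨L₂, c2, ?_, a2⟩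
    rw [List.length_cons]
    omega

end

theorem Computes.exists_nandChain {m : ℕ} {X : List Instr} {f : (Fin m → Bool) → Bool}
    (h : Computes X f) :
    ∃ L, NandChain L ∧ L.length ≤ 19 * X.length + 2 ∧ Avail L f := by
  obtain ⟨l, hl⟩ := (computes_iff X f).1 h
  set ρ : (Fin m → Bool) → Focus → Bool := fun b r =>
    match env l b r with
    | .BR x => x
    | .empty => false with hρ
  -- Two gates supply both constants; every initial bit is one of them or an input coordinate.
  have hL : NandChain (m := m) [fun _ => !(true && true), fun _ => true] :=
    .nand (.const .nil) (.inl (by simp)) (.inl (by simp))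
  have hc : ∀ c : Bool,
      Avail (m := m) [fun _ => !(true && true), fun _ => true] fun _ => c := by
    intro c
    cases c <;> simp [Avail]
  have ht : Tracks [fun _ => !(true && true), fun _ => true] (fun _ => some 0) ρ := by
    refine ⟨fun k => hc _, fun r => ?_⟩
    cases r with
    | inp i =>
      by_cases hi : i < m
      · exact .inr ⟨⟨i, hi⟩, by simp [hρ, env, hi]⟩
      · convert hc false using 2 with b
        simp [hρ, env, hi]
    | aux j =>
      convert hc false using 2 with b
      by_cases hj : j < l <;> simp [hρ, env, hj]
    | out => exact hc false
  obtain ⟨L', c', l', a'⟩ := ht.sweep hL X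
  refine ⟨L', c', by simpa [add_comm] using l', ?_⟩
  convert a' using 2 with b
  refine (sweep_eq_of_run X 0 _ _ (fun r y hy => ?_) _ (hl b)).symm
  simp [hρ, hy]

/-! ### Evaluating chains of NAND gates on a tape -/

/-- The effect of a three-bit command on an accumulator and a tape, given by the cells to the left
of the head, nearest first, and the cells from the head on; further cells contain `false`. The
commands are: move left, move right, load the accumulator, NAND into the accumulator, store the
accumulator. -/
def command : Bool → Bool → Bool → Bool × List Bool × List Bool → Bool × List Bool × List Bool
  | false, false, _, (a, l, r) => (a, l.tail, l.head?.getD false :: r)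
  | false, true, _, (a, l, r) => (a, r.head?.getD false :: l, r.tail)
  | true, false, false, (_, l, r) => (r.head?.getD false, l, r.head?.getD false :: r.tail)
  | true, false, true, (a, l, r) =>
    (!(a && r.head?.getD false), l, r.head?.getD false :: r.tail)
  | true, true, _, (a, l, r) => (a, l, a :: r.tail)

/-- The final accumulator after executing all complete commands in a string. -/
def perform : List Bool → Bool × List Bool × List Bool → Bool
  | x :: y :: z :: P, c => perform P (command x y z c)
  | _, c => c.1

/-- The contents of the first `p` cells, last first. -/
def leftCells (τ : ℕ → Bool) : ℕ → List Bool
  | 0 => []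
  | p + 1 => τ p :: leftCells τ p

/-- The lists represent a tape with contents `τ` and head position `p`. -/
def OnTape (τ : ℕ → Bool) (p : ℕ) (l r : List Bool) : Prop :=
  l = leftCells τ p ∧ ∀ j, r.getD j false = τ (p + j)

/-- The commands lead from an accumulator, a tape and a head position to others. -/
def Leads (C : List Bool) (a : Bool) (τ : ℕ → Bool) (p : ℕ) (a' : Bool) (τ' : ℕ → Bool)
    (p' : ℕ) : Prop :=
  ∀ l r, OnTape τ p l r → ∃ l' r', OnTape τ' p' l' r' ∧
    ∀ P, perform (C ++ P) (a, l, r) = perform P (a', l', r')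

section
variable {a a' a'' : Bool} {τ τ' τ'' : ℕ → Bool} {p p' p'' : ℕ}

theorem Leads.refl : Leads [] a τ p a τ p := fun l r h => ⟨l, r, h, fun _ => rfl⟩

theorem Leads.trans {C C' : List Bool} (h : Leads C a τ p a' τ' p')
    (h' : Leads C' a' τ' p' a'' τ'' p'') : Leads (C ++ C') a τ p a'' τ'' p'' := by
  intro l r hl
  obtain ⟨l', r', hl', e⟩ := h l r hl
  obtain ⟨l'', r'', hl'', e'⟩ := h' l' r' hl'
  exact ⟨l'', r'', hl'', fun P => by rw [List.append_assoc, e, e']⟩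

theorem OnTape.head {l r : List Bool} (h : OnTape τ p l r) : r.head?.getD false = τ p := by
  have := h.2 0
  rwa [List.getD_eq_getElem?_getD, ← List.head?_eq_getElem?] at this

/-- The cells left of the head do not see a change at the head; an empty right part stands for false
cells, so writing there is sound too. -/
theorem OnTape.cons_tail {l r : List Bool} (h : OnTape τ p l r) (x : Bool) :
    OnTape (Function.update τ p x) p l (x :: r.tail) := by
  refine ⟨?_, fun j => ?_⟩
  · rw [h.1]
    have : ∀ q ≤ p, leftCells τ q = leftCells (Function.update τ p x) q := by
      intro q hq
      induction q with
      | zero => rfl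
      | succ q ih =>
        rw [leftCells, leftCells, ih (by omega), Function.update_of_ne (by omega)]
    exact this p le_rfl
  · cases j with
    | zero => simp
    | succ j =>
      rw [Function.update_of_ne (by omega), ← h.2]
      simp [List.getD_eq_getElem?_getD]

theorem leads_left : Leads [false, false, false] a τ (p + 1) a τ p := by
  rintro l r ⟨rfl, hr⟩
  refine ⟨leftCells τ p, τ p :: r, ⟨rfl, fun j => ?_⟩, fun P => rfl⟩
  cases j with
  | zero => simp
  | succ j =>
    have := hr j
    rw [Nat.add_right_comm] at this
    simpa [add_assoc] using this

theorem leads_right : Leads [false, true, false] a τ p a τ (p + 1) := by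
  intro l r h
  refine ⟨τ p :: l, r.tail, ⟨by rw [h.1, leftCells], fun j => ?_⟩, fun P => ?_⟩
  · rw [Nat.add_right_comm, Nat.add_assoc, ← h.2]
    simp [List.getD_eq_getElem?_getD]
  · simp [perform, command, h.head]

theorem leads_load : Leads [true, false, false] a τ p (τ p) τ p := by
  intro l r h
  refine ⟨l, τ p :: r.tail, by simpa using h.cons_tail (τ p), fun P => ?_⟩
  simp [perform, command, h.head]

theorem leads_nand : Leads [true, false, true] a τ p (!(a && τ p)) τ p := by
  intro l r h
  refine ⟨l, τ p :: r.tail, by simpa using h.cons_tail (τ p), fun P => ?_⟩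
  simp [perform, command, h.head]

theorem leads_store : Leads [true, true, false] a τ p a (Function.update τ p a) p := by
  intro l r h
  exact ⟨l, a :: r.tail, h.cons_tail a, fun P => rfl⟩

end

theorem exists_move (p q N : ℕ) (hp : p ≤ N) (hq : q ≤ N) :
    ∃ C : List Bool, C.length ≤ 3 * N ∧ ∀ a τ, Leads C a τ p a τ q := by
  have hR : ∀ k p, ∃ C : List Bool, C.length = 3 * k ∧ ∀ a τ, Leads C a τ p a τ (p + k) := by
    intro k p
    induction k with
    | zero => exact ⟨[], rfl, fun _ _ => .refl⟩
    | succ k ih =>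
      obtain ⟨C, hC, h⟩ := ih
      refine ⟨C ++ [false, true, false], ?_, fun a τ => (h a τ).trans leads_right⟩
      rw [List.length_append, hC]
      simp
      ring
  have hL : ∀ k p, ∃ C : List Bool, C.length = 3 * k ∧ ∀ a τ, Leads C a τ (p + k) a τ p := by
    intro k p
    induction k with
    | zero => exact ⟨[], rfl, fun _ _ => .refl⟩
    | succ k ih =>
      obtain ⟨C, hC, h⟩ := ih
      refine ⟨[false, false, false] ++ C, ?_, fun a τ => leads_left.trans (h a τ)⟩
      rw [List.length_append, hC]
      simp
      ring
  rcases le_total p q with h | h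
  · obtain ⟨k, rfl⟩ := Nat.exists_eq_add_of_le h
    obtain ⟨C, hC, h⟩ := hR k p
    exact ⟨C, by omega, h⟩
  · obtain ⟨k, rfl⟩ := Nat.exists_eq_add_of_le h
    obtain ⟨C, hC, h⟩ := hL k q
    exact ⟨C, by omega, h⟩

/-- The tape holds the arguments `b` in its first cells and the values at `b` of the functions in
`L` in the next cells. -/
structure TapeHolds {m : ℕ} (L : List ((Fin m → Bool) → Bool)) (b : Fin m → Bool)
    (τ : ℕ → Bool) : Prop where
  inp : ∀ i : Fin m, τ i = b i
  mem : ∀ L₁ f L₂, L = L₁ ++ f :: L₂ → τ (m + L₂.length) = f b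

section
variable {m : ℕ} {L : List ((Fin m → Bool) → Bool)}

theorem Avail.exists_cell {f : (Fin m → Bool) → Bool} (h : Avail L f) :
    ∃ q ≤ m + L.length, ∀ b τ, TapeHolds L b τ → τ q = f b := by
  rcases h with h | ⟨i, rfl⟩
  · obtain ⟨L₁, L₂, rfl⟩ := List.append_of_mem h
    refine ⟨m + L₂.length, by simp; omega, fun b τ h => h.mem _ _ _ rfl⟩
  · exact ⟨i, by omega, fun b τ h => h.inp i⟩

theorem TapeHolds.cons {b : Fin m → Bool} {τ : ℕ → Bool} (h : TapeHolds L b τ)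
    (f : (Fin m → Bool) → Bool) :
    TapeHolds (f :: L) b (Function.update τ (m + L.length) (f b)) where
  inp i := by rw [Function.update_of_ne (by omega), h.inp]
  mem L₁ f' L₂ e := by
    cases L₁ with
    | nil =>
      obtain ⟨rfl, rfl⟩ := List.cons.inj e
      simp
    | cons f₁ L₁ =>
      obtain ⟨rfl, rfl⟩ := List.cons.inj e
      rw [Function.update_of_ne (by simp; omega)]
      exact h.mem _ _ _ rfl

/-- There are commands that compute the functions in `L` on the tape. -/
theorem NandChain.exists_commands (hL : NandChain L) (p N : ℕ) (hp : p ≤ N)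
    (hN : m + L.length ≤ N) :
    ∃ (C : List Bool) (q : ℕ), q ≤ N ∧ C.length ≤ L.length * (9 * N + 12) ∧
      ∀ a b τ, TapeHolds [] b τ → ∃ a' τ', TapeHolds L b τ' ∧ Leads C a τ p a' τ' q := by
  induction hL with
  | nil => exact ⟨[], p, hp, by simp, fun a b τ h => ⟨a, τ, h, .refl⟩⟩
  | @const L hL ih =>
    rw [List.length_cons] at hN
    obtain ⟨C, q, hq, hC, h⟩ := ih (by omega)
    obtain ⟨C₁, hC₁, h₁⟩ := exists_move q (m + L.length) N hq (by omega)
    -- No command yields a constant: loading a cell and applying NAND with that same cell twice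
    -- gives first its negation, then true.
    refine ⟨C ++ (C₁ ++ ([true, false, false] ++ ([true, false, true] ++ ([true, false, true] ++
      [true, true, false])))), m + L.length, by omega, ?_, fun a b τ hτ => ?_⟩
    · simp only [List.length_append, List.length_cons, List.length_nil]
      rw [Nat.add_mul, one_mul]
      omega
    · obtain ⟨a', τ', h', hl⟩ := h a b τ hτ
      refine ⟨true, _, h'.cons _, hl.trans ((h₁ _ _).trans (leads_load.trans (leads_nand.trans
        (leads_nand.trans ?_))))⟩
      simp only [Bool.and_self, Bool.not_and_self, Bool.not_false]
      exact leads_store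
  | @nand L x y hL hx hy ih =>
    rw [List.length_cons] at hN
    obtain ⟨C, q, hq, hC, h⟩ := ih (by omega)
    obtain ⟨qx, hqx, hx⟩ := hx.exists_cell
    obtain ⟨qy, hqy, hy⟩ := hy.exists_cell
    obtain ⟨C₁, hC₁, h₁⟩ := exists_move q qx N hq (by omega)
    obtain ⟨C₂, hC₂, h₂⟩ := exists_move qx qy N (by omega) (by omega)
    obtain ⟨C₃, hC₃, h₃⟩ := exists_move qy (m + L.length) N (by omega) (by omega)
    -- Go to `x` and load, go to `y` and NAND, go to the new cell and store: three moves of at most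
    -- `3 * N` bits and three commands.
    refine ⟨C ++ (C₁ ++ ([true, false, false] ++ (C₂ ++ ([true, false, true] ++ (C₃ ++
      [true, true, false]))))), m + L.length, by omega, ?_, fun a b τ hτ => ?_⟩
    · simp only [List.length_append, List.length_cons, List.length_nil]
      rw [Nat.add_mul, one_mul]
      omega
    · obtain ⟨a', τ', h', hl⟩ := h a b τ hτ
      refine ⟨!(x b && y b), _, h'.cons _, hl.trans ((h₁ _ _).trans (leads_load.trans ((h₂ _ _).trans
        (leads_nand.trans ((h₃ _ _).trans ?_)))))⟩
      rw [hx b τ' h', hy b τ' h']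
      exact leads_store

/-- A provided function can be evaluated by a command string. -/
theorem NandChain.exists_perform (hL : NandChain L) {f : (Fin m → Bool) → Bool} (hf : Avail L f)
    (p : ℕ) (hp : p ≤ m) :
    ∃ C : List Bool, C.length ≤ (L.length + 1) * (9 * (m + L.length) + 12) ∧
      ∀ (b : Fin m → Bool) (τ : ℕ → Bool), (∀ i : Fin m, τ i = b i) → ∀ a l r,
        OnTape τ p l r → perform C (a, l, r) = f b := by
  obtain ⟨C, q, hq, hC, h⟩ := hL.exists_commands p (m + L.length) (by omega) le_rfl
  obtain ⟨q', hq', hf⟩ := hf.exists_cell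
  obtain ⟨C', hC', h'⟩ := exists_move q q' (m + L.length) hq hq'
  refine ⟨C ++ (C' ++ [true, false, false]), ?_, fun b τ hτ a l r hlr => ?_⟩
  · simp only [List.length_append, List.length_cons, List.length_nil]
    rw [Nat.add_mul, one_mul]
    omega
  · obtain ⟨a', τ', ht, hl⟩ := h a b τ ⟨hτ, by simp⟩
    obtain ⟨l', r', -, he⟩ := (hl.trans ((h' _ _).trans leads_load)) l r hlr
    have := he []
    rw [List.append_nil] at this
    rw [this, perform, hf b τ' ht]
    simp

end

/-! ### The verifier -/

/-- Reads blocks of four equal bits, up to the first other block, and prepends the bits to a list;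
returns that list and the remaining string. -/
def readQuads : List Bool → List Bool → List Bool × List Bool
  | l, a :: b :: c :: d :: r =>
    if a = b ∧ b = c ∧ c = d then readQuads (a :: l) r else (l, r)
  | l, _ => (l, [])

/-- Reads blocks of two equal bits, up to the first other block, and prepends the bits to a list;
returns that list and the remaining string. -/
def readPairs : List Bool → List Bool → List Bool × List Bool
  | l, a :: b :: r => if a = b then readPairs (a :: l) r else (l, r)
  | l, _ => (l, [])

/-- The function computed by the verifier: in a string that encodes an input, an advice and a
certificate, the reversed advice is executed as a command string on the tape that consists of the
input and the certificate, with the head at the start of the certificate. -/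
def verify (x : List Bool) : Bool :=
  perform (readPairs [] (readQuads [] x).2).1
    (true, (readQuads [] x).1, (readPairs [] (readQuads [] x).2).2)

/-- Nested pairing repeats each input bit four times and doubles the inner separator to `1100`, the
first block of four that is not constant. -/
theorem readQuads_append (l w r : List Bool) :
    readQuads l ((w.flatMap fun b => [b, b]).flatMap (fun b => [b, b]) ++
      true :: true :: false :: false :: r) = (w.reverse ++ l, r) := by
  induction w generalizing l with
  | nil => simp [readQuads]
  | cons a w ih => simp [readQuads, ih]

theorem readPairs_append (l w r : List Bool) :
    readPairs l (w.flatMap (fun b => [b, b]) ++ true :: false :: r) = (w.reverse ++ l, r) := by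
  induction w generalizing l with
  | nil => simp [readPairs]
  | cons a w ih => simp [readPairs, ih]

/-- Reading onto a list reverses: the input becomes the left part of the tape, nearest cell first,
as wanted, while the advice comes out backwards and so has to be supplied reversed. -/
theorem verify_pairing (w a c : List Bool) :
    verify (pairing (pairing w a) c) = perform a.reverse (true, w.reverse, c) := by
  have h : pairing (pairing w a) c = (w.flatMap fun b => [b, b]).flatMap (fun b => [b, b]) ++
      true :: true :: false :: false :: (a.flatMap (fun b => [b, b]) ++ true :: false :: c) := by
    simp [pairing, List.flatMap_append]
  simp [verify, h, readQuads_append, readPairs_append]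

/-! ### The verifier as a stack machine -/

/-- The stacks of the verifier. -/
inductive VStack
  | left
  | right
  | prog
deriving DecidableEq

instance : Fintype VStack := ⟨{.left, .right, .prog}, fun k => by cases k <;> simp⟩

/-- The labels of the verifier. -/
inductive VLabel
  | quads
  | pairs
  | perform
  | drain
deriving DecidableEq

instance : Fintype VLabel :=
  ⟨{.quads, .pairs, .perform, .drain}, fun k => by cases k <;> simp⟩

/-- The states of the verifier: the accumulator and four popped bits. -/
abbrev VState := Bool × Option Bool × Option Bool × Option Bool × Option Bool

/-- The accumulator and the cell at the head after a command that is not a move. -/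
def operate : VState → VState
  | (a, x, y, z, h) =>
    if y = some true then (a, x, y, z, some a)
    else if z = some true then (!(a && h.getD false), x, y, z, h)
    else (h.getD false, x, y, z, h)

open TM2.Stmt in
/-- The program of the verifier. -/
def verifierProgram : VLabel → TM2.Stmt (fun _ : VStack => Bool) VLabel VState
  | .quads =>
    pop .right (fun v x => (v.1, x, none, none, none)) <|
    pop .right (fun v x => (v.1, v.2.1, x, none, none)) <|
    pop .right (fun v x => (v.1, v.2.1, v.2.2.1, x, none)) <|
    pop .right (fun v x => (v.1, v.2.1, v.2.2.1, v.2.2.2.1, x)) <|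
    branch (fun v => v.2.2.2.2.isSome && decide (v.2.1 = v.2.2.1) &&
        decide (v.2.2.1 = v.2.2.2.1) && decide (v.2.2.2.1 = v.2.2.2.2))
      (push .left (fun v => v.2.1.getD false) <| goto fun _ => .quads)
      (goto fun _ => .pairs)
  | .pairs =>
    pop .right (fun v x => (v.1, x, none, none, none)) <|
    pop .right (fun v x => (v.1, v.2.1, x, none, none)) <|
    branch (fun v => v.2.2.1.isSome && decide (v.2.1 = v.2.2.1))
      (push .prog (fun v => v.2.1.getD false) <| goto fun _ => .pairs)
      (goto fun _ => .perform)
  | .perform =>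
    pop .prog (fun v x => (v.1, x, none, none, none)) <|
    pop .prog (fun v x => (v.1, v.2.1, x, none, none)) <|
    pop .prog (fun v x => (v.1, v.2.1, v.2.2.1, x, none)) <|
    branch (fun v => v.2.2.2.1.isSome)
      (branch (fun v => decide (v.2.1 = some true))
        (pop .right (fun v x => (v.1, v.2.1, v.2.2.1, v.2.2.2.1, x)) <|
          load operate <|
          push .right (fun v => v.2.2.2.2.getD false) <| goto fun _ => .perform)
        (branch (fun v => decide (v.2.2.1 = some true))
          (pop .right (fun v x => (v.1, v.2.1, v.2.2.1, v.2.2.2.1, x)) <|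
            push .left (fun v => v.2.2.2.2.getD false) <| goto fun _ => .perform)
          (pop .left (fun v x => (v.1, v.2.1, v.2.2.1, v.2.2.2.1, x)) <|
            push .right (fun v => v.2.2.2.2.getD false) <| goto fun _ => .perform)))
      (goto fun _ => .drain)
  | .drain =>
    pop .left (fun v x => (v.1, x, none, none, none)) <|
    pop .right (fun v x => (v.1, v.2.1, x, none, none)) <|
    branch (fun v => v.2.1.isSome || v.2.2.1.isSome)
      (goto fun _ => .drain)
      (push .prog (fun v => v.1) <| load (fun _ => (true, none, none, none, none)) halt)

/-- The verifier as a stack machine. -/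
def verifier : FinTM2 where
  K := VStack
  k₀ := .right
  k₁ := .prog
  Γ _ := Bool
  Λ := VLabel
  main := .quads
  σ := VState
  initialState := (true, none, none, none, none)
  Γk₀Fin := inferInstanceAs (Fintype Bool)
  m := verifierProgram

/-! ### Correctness and running time of the verifier -/

/-- The stacks with given contents. -/
def vstacks (l r p : List Bool) : VStack → List Bool
  | .left => l
  | .right => r
  | .prog => p

@[simp] theorem update_left (l r p x : List Bool) :
    Function.update (vstacks l r p) .left x = vstacks x r p := by
  funext k; cases k <;> rfl

@[simp] theorem update_right (l r p x : List Bool) :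
    Function.update (vstacks l r p) .right x = vstacks l x p := by
  funext k; cases k <;> rfl

@[simp] theorem update_prog (l r p x : List Bool) :
    Function.update (vstacks l r p) .prog x = vstacks l r x := by
  funext k; cases k <;> rfl

/-- The configuration with a given label, state and contents of the stacks. -/
def vcfg (lab : VLabel) (v : VState) (l r p : List Bool) : verifier.Cfg :=
  ⟨some lab, v, vstacks l r p⟩

/-- The configurations are related by at most `n` steps of the verifier. -/
def Within (n : ℕ) (c c' : verifier.Cfg) : Prop :=
  ∃ s ≤ n, (flip bind verifier.step)^[s] (some c) = some c'

theorem Within.step {n : ℕ} {c c₁ c' : verifier.Cfg} (h : verifier.step c = some c₁)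
    (h' : Within n c₁ c') : Within (n + 1) c c' := by
  obtain ⟨s, hs, e⟩ := h'
  refine ⟨s + 1, by omega, ?_⟩
  rw [Function.iterate_succ_apply]
  have : flip bind verifier.step (some c) = some c₁ := h
  rw [this, e]

theorem Within.trans {n n' : ℕ} {c c₁ c' : verifier.Cfg} (h : Within n c c₁)
    (h' : Within n' c₁ c') : Within (n + n') c c' := by
  obtain ⟨s, hs, e⟩ := h
  obtain ⟨s', hs', e'⟩ := h'
  exact ⟨s' + s, by omega, by rw [Function.iterate_add_apply, e, e']⟩

theorem Within.mono {n n' : ℕ} {c c' : verifier.Cfg} (h : Within n c c') (hn : n ≤ n') :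
    Within n' c c' := by
  obtain ⟨s, hs, e⟩ := h
  exact ⟨s, by omega, e⟩

theorem within_one {c c' : verifier.Cfg} (h : verifier.step c = some c') : Within 1 c c' :=
  .step h ⟨0, le_rfl, rfl⟩

theorem step_vcfg {lab lab' : VLabel} {v v' : VState} {l r p l' r' p' : List Bool}
    (h : TM2.stepAux (verifierProgram lab) v (vstacks l r p) =
      ⟨some lab', v', vstacks l' r' p'⟩) :
    verifier.step (vcfg lab v l r p) = some (vcfg lab' v' l' r' p') :=
  congrArg some h

theorem within_quads (l r : List Bool) (v : VState) :
    ∃ v', v'.1 = v.1 ∧ Within (r.length + 1) (vcfg .quads v l r [])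
      (vcfg .pairs v' (readQuads l r).1 (readQuads l r).2 []) := by
  induction l, r using readQuads.induct generalizing v with
  | case1 l a b c d r h ih =>
    obtain ⟨rfl, rfl, rfl⟩ := h
    obtain ⟨v', hv', h⟩ := ih (v.1, some a, some a, some a, some a)
    refine ⟨v', hv', ?_⟩
    rw [readQuads, if_pos ⟨rfl, rfl, rfl⟩]
    refine (Within.step (step_vcfg ?_) h).mono (by simp)
    simp [verifierProgram, vstacks]
  | case2 l a b c d r h =>
    refine ⟨(v.1, some a, some b, some c, some d), rfl, ?_⟩
    rw [readQuads, if_neg h]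
    refine (within_one (step_vcfg ?_)).mono (Nat.le_add_left 1 _)
    have h' : (a = b → b = c → ¬ c = d) := fun h1 h2 h3 => h ⟨h1, h2, h3⟩
    revert h'
    cases a <;> cases b <;> cases c <;> cases d <;> simp [verifierProgram, vstacks]
  | case3 r l h =>
    refine ⟨(v.1, r[0]?, r[1]?, r[2]?, none), rfl, ?_⟩
    rcases r with _ | ⟨a, _ | ⟨b, _ | ⟨c, _ | ⟨d, r⟩⟩⟩⟩
    iterate 4
      refine (within_one (step_vcfg ?_)).mono (Nat.le_add_left 1 _)
      simp [verifierProgram, vstacks, readQuads]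
    exact absurd rfl (h a b c d r)

theorem within_pairs (p r l : List Bool) (v : VState) :
    ∃ v', v'.1 = v.1 ∧ Within (r.length + 1) (vcfg .pairs v l r p)
      (vcfg .perform v' l (readPairs p r).2 (readPairs p r).1) := by
  induction p, r using readPairs.induct generalizing v with
  | case1 p a r ih =>
    obtain ⟨v', hv', h⟩ := ih (v.1, some a, some a, none, none)
    refine ⟨v', hv', ?_⟩
    rw [readPairs, if_pos rfl]
    refine (Within.step (step_vcfg ?_) h).mono (by simp)
    simp [verifierProgram, vstacks]
  | case2 p a b r h =>
    refine ⟨(v.1, some a, some b, none, none), rfl, ?_⟩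
    rw [readPairs, if_neg h]
    refine (within_one (step_vcfg ?_)).mono (Nat.le_add_left 1 _)
    simp [verifierProgram, vstacks, h]
  | case3 r p h =>
    refine ⟨(v.1, r[0]?, none, none, none), rfl, ?_⟩
    rcases r with _ | ⟨a, _ | ⟨b, r⟩⟩
    iterate 2
      refine (within_one (step_vcfg ?_)).mono (Nat.le_add_left 1 _)
      simp [verifierProgram, vstacks, readPairs]
    exact absurd rfl (h a b r)

/-- The bound on the final tape is what limits the time for emptying it: a command uses up three
program bits and adds at most two cells. -/
theorem within_perform (p : List Bool) (c : Bool × List Bool × List Bool) (v : VState)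
    (hv : v.1 = c.1) :
    ∃ v' l r, v'.1 = perform p c ∧ l.length + r.length ≤ c.2.1.length + c.2.2.length + p.length ∧
      Within (p.length + 1) (vcfg .perform v c.2.1 c.2.2 p) (vcfg .drain v' l r []) := by
  induction p, c using perform.induct generalizing v with
  | case1 x y z p c ih =>
    obtain ⟨a, l, r⟩ := c
    obtain ⟨a', v⟩ := v
    obtain rfl : a' = a := hv
    obtain ⟨w, hw, hstep⟩ : ∃ w : VState, w.1 = (command x y z (a', l, r)).1 ∧
        TM2.stepAux (verifierProgram .perform) (a', v) (vstacks l r (x :: y :: z :: p)) =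
          ⟨some .perform, w, vstacks (command x y z (a', l, r)).2.1
            (command x y z (a', l, r)).2.2 p⟩ := by
      cases x
      · cases y
        · exact ⟨(a', some false, some false, some z, l.head?), rfl, by
            simp [verifierProgram, vstacks, command]⟩
        · exact ⟨(a', some false, some true, some z, r.head?), rfl, by
            simp [verifierProgram, vstacks, command]⟩
      · cases y
        · cases z
          · exact ⟨(r.head?.getD false, some true, some false, some false, r.head?), rfl, by
              simp [verifierProgram, vstacks, command, operate]⟩
          · exact ⟨(!(a' && r.head?.getD false), some true, some false, some true, r.head?), rfl,
              by simp [verifierProgram, vstacks, command, operate]⟩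
        · exact ⟨(a', some true, some true, some z, some a'), rfl, by
            simp [verifierProgram, vstacks, command, operate]⟩
    obtain ⟨v', l', r', h1, h2, h3⟩ := ih w hw
    refine ⟨v', l', r', h1, h2.trans ?_, (Within.step (step_vcfg hstep) h3).mono (by simp)⟩
    have : (command x y z (a', l, r)).2.1.length + (command x y z (a', l, r)).2.2.length ≤
        l.length + r.length + 2 := by
      cases x <;> cases y <;> cases z <;> simp [command] <;> omega
    simp only [List.length_cons]
    omega
  | case2 p c h =>
    obtain ⟨a, l, r⟩ := c
    obtain ⟨a', v⟩ := v
    obtain rfl : a' = a := hv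
    refine ⟨(a', p[0]?, p[1]?, none, none), l, r, ?_⟩
    rcases p with _ | ⟨x, _ | ⟨y, _ | ⟨z, p⟩⟩⟩
    iterate 3
      refine ⟨by simp [perform], by simp, (within_one (step_vcfg ?_)).mono (Nat.le_add_left 1 _)⟩
      simp [verifierProgram, vstacks]
    exact absurd rfl (h x y z p)

theorem haltList_verifier (a : Bool) : haltList verifier [a] =
    ⟨none, (true, none, none, none, none), vstacks [] [] [a]⟩ := by
  simp only [haltList]
  congr 1
  funext k
  cases k <;> rfl

theorem initList_verifier (x : List Bool) : initList verifier x =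
    vcfg .quads (true, none, none, none, none) [] x [] := by
  simp only [initList, vcfg]
  congr 1
  funext k
  cases k <;> rfl

/-- A halting configuration must have all stacks other than the output stack empty and the state
reset, hence this phase. -/
theorem within_drain (n : ℕ) (l r : List Bool) (v : VState) (hl : l.length ≤ n)
    (hr : r.length ≤ n) : Within (n + 1) (vcfg .drain v l r []) (haltList verifier [v.1]) := by
  induction n generalizing l r v with
  | zero =>
    obtain rfl : l = [] := by simpa using hl
    obtain rfl : r = [] := by simpa using hr
    rw [haltList_verifier]
    refine within_one (congrArg some ?_)
    change TM2.stepAux (verifierProgram .drain) v (vstacks [] [] []) = _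
    simp [verifierProgram, vstacks]
    rfl
  | succ n ih =>
    by_cases h : l = [] ∧ r = []
    · obtain ⟨rfl, rfl⟩ := h
      exact (ih [] [] v (by simp) (by simp)).mono (by omega)
    · refine Within.step (step_vcfg ?_) (ih l.tail r.tail (v.1, l.head?, r.head?, none, none)
        (by simp; omega) (by simp; omega))
      rcases l with _ | ⟨a, l⟩ <;> rcases r with _ | ⟨b, r⟩ <;>
        simp_all [verifierProgram, vstacks]

theorem length_readQuads (l r : List Bool) :
    (readQuads l r).1.length + (readQuads l r).2.length ≤ l.length + r.length := by
  induction l, r using readQuads.induct with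
  | case1 l a b c d r h ih =>
    rw [readQuads, if_pos h]
    simp only [List.length_cons] at ih ⊢
    omega
  | case2 l a b c d r h =>
    rw [readQuads, if_neg h]
    simp only [List.length_cons]
    omega
  | case3 r l h =>
    rcases r with _ | ⟨a, _ | ⟨b, _ | ⟨c, _ | ⟨d, r⟩⟩⟩⟩
    iterate 4
      simp [readQuads]
    exact absurd rfl (h a b c d r)

theorem length_readPairs (l r : List Bool) :
    (readPairs l r).1.length + (readPairs l r).2.length ≤ l.length + r.length := by
  induction l, r using readPairs.induct with
  | case1 l a r ih =>
    rw [readPairs, if_pos rfl]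
    simp only [List.length_cons] at ih ⊢
    omega
  | case2 l a b r h =>
    rw [readPairs, if_neg h]
    simp only [List.length_cons]
    omega
  | case3 r l h =>
    rcases r with _ | ⟨a, _ | ⟨b, r⟩⟩
    iterate 2
      simp [readPairs]
    exact absurd rfl (h a b r)

theorem within_verify (x : List Bool) :
    Within (6 * x.length + 4) (initList verifier x) (haltList verifier [verify x]) := by
  obtain ⟨v₁, hv₁, h₁⟩ := within_quads [] x (true, none, none, none, none)
  obtain ⟨v₂, hv₂, h₂⟩ := within_pairs [] (readQuads [] x).2 (readQuads [] x).1 v₁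
  obtain ⟨v₃, l, r, hv₃, hlr, h₃⟩ := within_perform (readPairs [] (readQuads [] x).2).1
    (true, (readQuads [] x).1, (readPairs [] (readQuads [] x).2).2) v₂ (hv₂.trans hv₁)
  have h₄ := within_drain (l.length + r.length) l r v₃ (by omega) (by omega)
  rw [hv₃] at h₄
  rw [initList_verifier]
  have e₁ := length_readQuads [] x
  have e₂ := length_readPairs [] (readQuads [] x).2
  simp only [List.length_nil] at e₁ e₂
  exact (((h₁.trans h₂).trans h₃).trans h₄).mono (by simp only at hlr; omega)

theorem verify_mem_PTime : verify ∈ PTime := by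
  have h : ∀ x : List Bool, Nonempty (StateTransition.EvalsToInTime verifier.step (initList verifier x)
      (some (haltList verifier [verify x])) (6 * x.length + 4)) := by
    intro x
    obtain ⟨s, hs, e⟩ := within_verify x
    -- `Within` is a proposition whereas the machine model asks for data, so the evaluation is
    -- wrapped in `Nonempty` and extracted by choice.
    exact ⟨⟨⟨s, e⟩, hs⟩⟩
  have h' : ∀ x : List Bool, TM2OutputsInTime verifier (List.map (Equiv.refl Bool).invFun x)
      (some (List.map (Equiv.refl Bool).invFun (Computability.encodeBool (verify x))))
      ((Polynomial.C 6 * Polynomial.X + Polynomial.C 4 : Polynomial ℕ).eval x.length) := by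
    intro x
    have hx : List.map (Equiv.refl Bool).invFun x = x := List.map_id x
    have ht : (Polynomial.C 6 * Polynomial.X + Polynomial.C 4 : Polynomial ℕ).eval x.length =
        6 * x.length + 4 := by simp
    have key : ∀ y : List Bool, y = x → TM2OutputsInTime verifier y
        (some [verify x]) (6 * x.length + 4) := by
      rintro _ rfl
      exact (h _).some
    rw [ht]
    exact key _ hx
  exact ⟨{ tm := verifier
           inputAlphabet := Equiv.refl Bool
           outputAlphabet := Equiv.refl Bool
           time := Polynomial.C 6 * Polynomial.X + Polynomial.C 4
           outputsFun := h' }, fun k => (inferInstance : Finite Bool)⟩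

/-! ### Families in NPLIS belong to NP/poly -/

theorem leftCells_getD (x : List Bool) (p : ℕ) (hp : p ≤ x.length) :
    leftCells (fun i => x.getD i false) p = (x.take p).reverse := by
  induction p with
  | zero => simp [leftCells]
  | succ p ih =>
    rw [leftCells, ih (by omega), List.take_succ_eq_append_getElem (by omega),
      List.reverse_append]
    simp [List.getD_eq_getElem?_getD, List.getElem?_eq_getElem (show p < x.length by omega)]

theorem onTape_append (w c : List Bool) :
    OnTape (fun i => (w ++ c).getD i false) w.length w.reverse c := by
  refine ⟨?_, fun j => ?_⟩
  · rw [leftCells_getD _ _ (by simp)]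
    simp
  · simp [List.getD_eq_getElem?_getD, List.getElem?_append_right]

theorem append_get_getD (w c : List Bool) (k : ℕ) (i : Fin (w.length + k)) :
    (w ++ c).getD i false = Fin.append w.get (fun i : Fin k => c.getD i false) i := by
  refine Fin.addCases (fun i => ?_) (fun i => ?_) i
  · simp [List.getD_eq_getElem?_getD, List.getElem?_append_left]
  · simp [List.getD_eq_getElem?_getD, List.getElem?_append_right]

theorem NPLIS_subset : familyEquiv '' NPLIS ⊆ NPpoly := by
  classical
  rintro _ ⟨F, ⟨h, hh, -, g, ⟨h', hh', hX⟩, hF⟩, rfl⟩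
  obtain ⟨p, hp⟩ := mem_poly_iff.1 hh
  obtain ⟨p', hp'⟩ := mem_poly_iff.1 hh'
  -- `M` bounds the arity `n + h n`, and `N` bounds the number of gates: 19 per instruction and 2
  -- for the constants.
  set M : Polynomial ℕ := Polynomial.X + p with hM
  set N : Polynomial ℕ := Polynomial.C 19 * p'.comp M + Polynomial.C 2 with hN
  have hC : ∀ n, ∃ C : List Bool,
      C.length ≤ ((N + Polynomial.C 1) * (Polynomial.C 9 * (M + N) + Polynomial.C 12)).eval n ∧
      ∀ w c : List Bool, w.length = n → perform C (true, w.reverse, c) =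
        g (w.length + h w.length) (Fin.append w.get fun i => c.getD i false) := by
    intro n
    obtain ⟨X, -, hXc, hXl⟩ := hX (n + h n)
    obtain ⟨L, hL, hLl, hLf⟩ := hXc.exists_nandChain
    obtain ⟨C, hCl, hC⟩ := hL.exists_perform hLf n (by omega)
    refine ⟨C, hCl.trans ?_, ?_⟩
    · have h1 : n + h n ≤ M.eval n := by
        rw [hM, Polynomial.eval_add, Polynomial.eval_X]
        exact Nat.add_le_add_left (hp n) n
      have h2 : L.length ≤ N.eval n := by
        simp only [hN, Polynomial.eval_add, Polynomial.eval_mul, Polynomial.eval_C,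
          Polynomial.eval_comp]
        have h3 : p'.eval (n + h n) ≤ p'.eval (M.eval n) := eval_mono p' h1
        have h4 := hp' (n + h n)
        omega
      simp only [Polynomial.eval_add, Polynomial.eval_mul, Polynomial.eval_C]
      gcongr
    · rintro w c rfl
      exact hC _ _ (append_get_getD w c _) _ _ _ (onTape_append w c)
  choose C hCl hC using hC
  refine ⟨fun x => decide (∃ c : List Bool, c.length = p.eval x.length ∧
    verify (pairing x c) = true), ⟨p, verify, verify_mem_PTime, fun x => by simp⟩,
    fun n => (C n).length, mem_poly_iff.2 ⟨_, hCl⟩, fun n => (C n).reverse, by simp, fun w => ?_⟩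
  have hv : ∀ c, verify (pairing (pairing w (C w.length).reverse) c) =
      g (w.length + h w.length) (Fin.append w.get fun i => c.getD i false) := by
    intro c
    rw [verify_pairing, List.reverse_reverse, hC w.length w c rfl]
  rw [Bool.eq_iff_iff, decide_eq_true_iff]
  simp only [hv]
  change F w.length w.get = true ↔ _
  rw [hF]
  constructor
  · rintro ⟨c, hc⟩
    set x := pairing w (C w.length).reverse with hx
    have hlen : h w.length ≤ p.eval x.length := by
      refine (hp _).trans (eval_mono p ?_)
      rw [hx, length_pairing]
      omega
    -- The NP certificate must have length exactly `p` at the length of the paired string, which is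
    -- at least `h n`; the surplus bits lie on cells that do not influence the result.
    refine ⟨List.ofFn c ++ List.replicate (p.eval x.length - h w.length) false, ?_, ?_⟩
    · rw [List.length_append, List.length_ofFn, List.length_replicate]
      omega
    · convert hc using 3
      funext i
      simp [List.getD_eq_getElem?_getD, List.getElem?_append_left]
  · rintro ⟨c, -, hc⟩
    exact ⟨_, hc⟩

end InSeq

/-- Under the identification of Boolean function families with functions on bit strings, NPLIS
coincides with NP/poly. -/
theorem mainTheorem2 : InSeq.familyEquiv '' InSeq.NPLIS = InSeq.NPpoly :=
  Set.Subset.antisymm InSeq.NPLIS_subset InSeq.NPpoly_subset
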